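/- For $\beta>0$ and $N\ge 2$ let $$p_{N,\beta}(\theta_1,\dots,\theta_N)=\frac1{Z_{N,\beta}}\prod_{1\le j<k\le N}\bigl|e^{i\theta_k}-e^{i\theta_j}\bigr|^{\beta},\qquad Z_{N,\beta}=\int_{[0,2\pi)^N}\prod_{1\le j<k\le N}\bigl|e^{i\theta_k}-e^{i\theta_j}\bigr|^{\beta}\,d\theta_1\cdots d\theta_N,$$ be the eigenvalue probability density of the circular $\beta$-ensemble (extended $2\pi$-periodically in each angle), let $$\rho_{(2),N}(\theta_1,\theta_2)=N(N-1)\int_{[0,2\pi)^{N-2}}p_{N,\beta}(\theta_1,\dots,\theta_N)\,d\theta_3\cdots d\theta_N$$ be its two-point correlation function, and let $$\rho_{(2),\infty}(X)=\lim_{N\to\infty}\Bigl(\frac{2\pi}{N}\Bigr)^2\rho_{(2),N}\Bigl(\frac{2\pi X}{N},0\Bigr)\qquad(X\in\mathbb R)$$ be its bulk scaling limit. Write $\operatorname{sinc}x=\frac{\sin x}{x}$ for $x\neq0$ and $\operatorname{sinc}0=1$. (a) For $\beta=2$ the limit $f(X)=\rho_{(2),\infty}(X)$ exists for every $X\in\mathbb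 R$, is a $C^\infty$ function of $X$, and satisfies for all $X\in\mathbb R$ $$X^3f^{(3)}(X)+4X^2f^{(2)}(X)+\bigl((2\pi X)^2-2\bigr)Xf'(X)-4f(X)=0 .$$ It has the closed form $f(X)=1-\operatorname{sinc}(\pi X)^2$. (b) For $\beta=4$ the limit $f(X)=\rho_{(2),\infty}(X)$ exists for every $X\in\mathbb R$, is a $C^\infty$ function of $X$, and satisfies for all $X\in\mathbb R$ $$\begin{aligned}&X^5f^{(5)}(X)+10X^4f^{(4)}(X)+(20\pi^2X^5+12X^3)f^{(3)}(X)+(64\pi^2X^4-40X^2)f^{(2)}(X)\\&\quad+(64\pi^4X^5-48\pi^2X^3-16X)f'(X)+(-32\pi^2X^2+16)f(X)=0 .\end{aligned}$$ It has the closed form $$f(X)=1-\operatorname{sinc}(2\pi X)^2+\frac1{2\pi}\Bigl(\frac{d}{dX}\operatorname{sinc}(2\pi X)\Bigr)\int_0^{2\pi X}\operatorname{sinc}(t)\,dt .$$ -/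

import Mathlib

open Filter Topology
open scoped ContDiff

noncomputable section

namespace CircularEnsemble

/-- The unnormalised eigenvalue weight `∏_{j < k} |e^{iθ_k} - e^{iθ_j}|^β` of the circular
`β`-ensemble of `N` eigenvalues. As a function of the angles it is `2π`-periodic in each of them. -/
def weight (β : ℝ) {N : ℕ} (θ : Fin N → ℝ) : ℝ :=
  ∏ j : Fin N, ∏ k ∈ Finset.Ioi j,
    ‖Complex.exp (Complex.I * (θ k : ℂ)) - Complex.exp (Complex.I * (θ j : ℂ))‖ ^ β

/-- The torus of angles `[0, 2π)^N`. -/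
def angles (N : ℕ) : Set (Fin N → ℝ) :=
  Set.univ.pi fun _ => Set.Ico 0 (2 * Real.pi)

/-- The normalisation of the circular `β`-ensemble. -/
def normalisation (N : ℕ) (β : ℝ) : ℝ :=
  ∫ θ in angles N, weight β θ

/-- The eigenvalue probability density function of the circular `β`-ensemble, with respect to
Lebesgue measure on `[0, 2π)^N`. -/
def density (β : ℝ) {N : ℕ} (θ : Fin N → ℝ) : ℝ :=
  weight β θ / normalisation N β

/-- The two-point correlation function of the circular `β`-ensemble with `N` eigenvalues:
`N (N - 1)` times the density integrated over all the angles but the first two. It vanishes when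
there are fewer than two eigenvalues. -/
def twoPoint (β : ℝ) : ℕ → ℝ → ℝ → ℝ
  | 0, _, _ => 0
  | 1, _, _ => 0
  | n + 2, θ₁, θ₂ =>
      ((n : ℝ) + 2) * ((n : ℝ) + 1) *
        ∫ φ in angles n, density β (Matrix.vecCons θ₁ (Matrix.vecCons θ₂ φ))

/-- The two-point correlation function in the variables `θ = 2πX/N`, in which the eigenvalue
density is one, with one of the two points at the origin. -/
def scaledTwoPoint (β : ℝ) (N : ℕ) (X : ℝ) : ℝ :=
  (2 * Real.pi / (N : ℝ)) ^ 2 * twoPoint β N (2 * Real.pi * X / (N : ℝ)) 0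

/-- The bulk scaled two-point correlation function: the pointwise limit as `N → ∞` of the scaled
two-point correlation function (meaningful where that limit exists). -/
def bulkTwoPoint (β : ℝ) (X : ℝ) : ℝ :=
  limUnder atTop fun N : ℕ => scaledTwoPoint β N X

end CircularEnsemble

end

/-! At `β = 2` and `β = 4` the weight is determinantal: `|Δ|²` is a product of two Vandermonde
determinants, and `|Δ|⁴` is, up to a nonzero constant, one confluent Vandermonde determinant of size
`2N` with half-integer frequencies (`exists_weight_four_eq_det`). Integrating out all angles but two
is then Fourier orthogonality: what survives is a sum over ordered pairs of distinct indices of a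
constant plus cosines of integer multiples of `s - t` (`integral_weight_two`,
`integral_weight_four`).

No explicit value of `Z` is needed. The cosines have nonzero frequency, so a further integration
keeps only the constant terms, and the unknown prefactor cancels in the quotient
(`twoPoint_eq_of_partial_integral`).

The diagonal terms of the pair sum vanish, so the sum may run over all pairs. Addition formulas
factor it into products of single sums, which after scaling are midpoint Riemann sums of continuous
functions on `[0, 1]` (`scaledTwoPoint_two`, `scaledTwoPoint_four`). Their limits are `sinc`, its
derivative and the sine integral, which gives existence and the closed forms.

For the differential equations, the function `x sinc x = sin x` yields a linear recurrence for the
derivatives of `sinc`. It reduces everything to polynomials in `x`, `sinc x`, `sinc' x` and the sine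
integral, and `sin² + cos² = 1` is the only relation left to use (`bulkTwo_ode`, `bulkFour_ode`). -/

namespace CircularEnsemble

open MeasureTheory intervalIntegral

/-! ### Derivatives of `sinc` and the sine integral -/

/-- The `k`-th derivative of `Real.sinc`, as an integral. -/
noncomputable def sincDeriv (k : ℕ) (x : ℝ) : ℝ :=
  ∫ t in (0 : ℝ)..1, t ^ k * Real.cos (x * t + k * (Real.pi / 2))

/-- Differentiation under the integral sign: each derivative brings down a factor `t` and advances
the phase by `π / 2`. The integral form needs no separate case at `x = 0`. -/
lemma hasDerivAt_sincDeriv (k : ℕ) (x : ℝ) :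
    HasDerivAt (sincDeriv k) (sincDeriv (k + 1) x) x := by
  have h := intervalIntegral.hasDerivAt_integral_of_dominated_loc_of_deriv_le
    (μ := volume) (a := (0 : ℝ)) (b := 1) (x₀ := x) (s := Set.univ) (bound := fun _ => 1)
    (F := fun x t => t ^ k * Real.cos (x * t + k * (Real.pi / 2)))
    (F' := fun x t => t ^ (k + 1) * Real.cos (x * t + ((k + 1 : ℕ) : ℝ) * (Real.pi / 2)))
    Filter.univ_mem ?_ ?_ ?_ ?_ ?_ ?_
  · exact h.2
  · exact Eventually.of_forall fun y =>
      (Continuous.aestronglyMeasurable (by fun_prop))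
  · exact Continuous.intervalIntegrable (by fun_prop) _ _
  · exact Continuous.aestronglyMeasurable (by fun_prop)
  · refine Eventually.of_forall fun t ht y _ => ?_
    rw [Set.uIoc_of_le zero_le_one] at ht
    rw [norm_mul, norm_pow, Real.norm_eq_abs, Real.norm_eq_abs, abs_of_pos ht.1]
    exact mul_le_one₀ (pow_le_one₀ ht.1.le ht.2) (abs_nonneg _) (Real.abs_cos_le_one _)
  · exact intervalIntegrable_const
  · refine Eventually.of_forall fun t _ y _ => ?_
    have h1 : HasDerivAt (fun y : ℝ => y * t + k * (Real.pi / 2)) t y := by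
      simpa using ((hasDerivAt_id y).mul_const t).add_const (k * (Real.pi / 2))
    have h2 := (h1.cos).const_mul (t ^ k)
    refine h2.congr_deriv ?_
    have : y * t + ((k + 1 : ℕ) : ℝ) * (Real.pi / 2)
        = (y * t + k * (Real.pi / 2)) + Real.pi / 2 := by push_cast; ring
    rw [this, Real.cos_add_pi_div_two]
    ring

lemma mul_sincDeriv_zero (x : ℝ) : x * sincDeriv 0 x = Real.sin x := by
  simp [sincDeriv]

lemma sincDeriv_zero : sincDeriv 0 = Real.sinc := by
  funext x
  rcases eq_or_ne x 0 with rfl | hx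
  · simp [sincDeriv]
  · rw [Real.sinc_of_ne_zero hx, eq_div_iff hx, mul_comm, mul_sincDeriv_zero]

lemma contDiff_sincDeriv (k : ℕ) : ContDiff ℝ ∞ (sincDeriv k) := by
  rw [contDiff_infty]
  intro n
  induction n generalizing k with
  | zero =>
    exact contDiff_zero.2 (continuous_iff_continuousAt.2 fun x =>
      (hasDerivAt_sincDeriv k x).continuousAt)
  | succ n ih =>
    rw [Nat.cast_succ, contDiff_succ_iff_deriv]
    refine ⟨fun x => (hasDerivAt_sincDeriv k x).differentiableAt, by simp, ?_⟩
    rw [show deriv (sincDeriv k) = sincDeriv (k + 1) from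
      funext fun x => (hasDerivAt_sincDeriv k x).deriv]
    exact ih (k + 1)

lemma mul_sincDeriv_one (x : ℝ) : x * sincDeriv 1 x + sincDeriv 0 x = Real.cos x := by
  have h := (hasDerivAt_id x).mul (hasDerivAt_sincDeriv 0 x)
  have h2 : HasDerivAt (id * sincDeriv 0) (Real.cos x) x := by
    rw [show id * sincDeriv 0 = Real.sin from funext mul_sincDeriv_zero]
    exact Real.hasDerivAt_sin x
  have := h.unique h2
  simp only [id, zero_add] at this
  linarith

/-- This is `sin² + cos² = 1`; in the differential equations it absorbs the constant `1` of the
closed forms. -/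
lemma sincDeriv_sq_relation (x : ℝ) :
    (x * sincDeriv 0 x) ^ 2 + (x * sincDeriv 1 x + sincDeriv 0 x) ^ 2 = 1 := by
  rw [mul_sincDeriv_zero, mul_sincDeriv_one, Real.sin_sq_add_cos_sq]

lemma mul_sincDeriv_two (x : ℝ) :
    x * sincDeriv 2 x + 2 * sincDeriv 1 x + x * sincDeriv 0 x = 0 := by
  have h := ((hasDerivAt_id x).mul (hasDerivAt_sincDeriv 1 x)).add (hasDerivAt_sincDeriv 0 x)
  have h2 : HasDerivAt (id * sincDeriv 1 + sincDeriv 0) (-Real.sin x) x := by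
    rw [show id * sincDeriv 1 + sincDeriv 0 = Real.cos from funext mul_sincDeriv_one]
    exact Real.hasDerivAt_cos x
  have := h.unique h2
  simp only [id, zero_add, Nat.reduceAdd] at this
  rw [mul_sincDeriv_zero]
  linarith

/-- The `(k + 1)`-st derivative of `mul_sincDeriv_two`. Unlike that identity it has a term of order
`k`, which comes from differentiating the factor `x`. -/
lemma mul_sincDeriv_add_three (k : ℕ) (x : ℝ) :
    x * sincDeriv (k + 3) x + (k + 3) * sincDeriv (k + 2) x + x * sincDeriv (k + 1) x
      + (k + 1) * sincDeriv k x = 0 := by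
  induction k generalizing x with
  | zero =>
    have h := (((hasDerivAt_id x).mul (hasDerivAt_sincDeriv 2 x)).add
      ((hasDerivAt_sincDeriv 1 x).const_mul 2)).add
        ((hasDerivAt_id x).mul (hasDerivAt_sincDeriv 0 x))
    have h2 := h.unique ((hasDerivAt_const x (0 : ℝ)).congr_of_eventuallyEq
      (Eventually.of_forall mul_sincDeriv_two))
    simp only [id, Nat.reduceAdd, zero_add] at h2
    push_cast
    simp only [zero_add]
    linarith
  | succ k ih =>
    have h := ((((hasDerivAt_id x).mul (hasDerivAt_sincDeriv (k + 3) x)).add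
      ((hasDerivAt_sincDeriv (k + 2) x).const_mul (k + 3 : ℝ))).add
        ((hasDerivAt_id x).mul (hasDerivAt_sincDeriv (k + 1) x))).add
          ((hasDerivAt_sincDeriv k x).const_mul (k + 1 : ℝ))
    have h2 := h.unique ((hasDerivAt_const x (0 : ℝ)).congr_of_eventuallyEq
      (Eventually.of_forall ih))
    simp only [id] at h2
    push_cast
    simp only [add_assoc, Nat.reduceAdd] at h2 ⊢
    linarith

/-- The sine integral. -/
noncomputable def sineIntegral (x : ℝ) : ℝ := ∫ t in (0 : ℝ)..x, Real.sinc t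

lemma hasDerivAt_sineIntegral (x : ℝ) : HasDerivAt sineIntegral (sincDeriv 0 x) x := by
  rw [sincDeriv_zero]
  exact integral_hasDerivAt_right (Real.continuous_sinc.intervalIntegrable _ _)
    (Real.continuous_sinc.stronglyMeasurableAtFilter _ _) Real.continuous_sinc.continuousAt

lemma contDiff_sineIntegral : ContDiff ℝ ∞ sineIntegral := by
  rw [contDiff_infty_iff_deriv]
  refine ⟨fun x => (hasDerivAt_sineIntegral x).differentiableAt, ?_⟩
  rw [show deriv sineIntegral = sincDeriv 0 from
    funext fun x => (hasDerivAt_sineIntegral x).deriv]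
  exact contDiff_sincDeriv 0

lemma sineIntegral_mul (x : ℝ) :
    ∫ t in (0 : ℝ)..1, x * Real.sinc (x * t) = sineIntegral x := by
  rw [intervalIntegral.integral_const_mul, mul_integral_comp_mul_left]
  simp [sineIntegral]

/-! ### The limit functions and their differential equations -/

/-- The bulk two-point function at `β = 2` in the variable `πX`. -/
noncomputable def bulkTwo (x : ℝ) : ℝ := 1 - sincDeriv 0 x ^ 2

/-- The bulk two-point function at `β = 4` in the variable `2πX`. -/
noncomputable def bulkFour (x : ℝ) : ℝ :=
  1 - sincDeriv 0 x ^ 2 + sincDeriv 1 x * sineIntegral x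

lemma contDiff_bulkTwo : ContDiff ℝ ∞ bulkTwo :=
  contDiff_const.sub ((contDiff_sincDeriv 0).pow 2)

lemma contDiff_bulkFour : ContDiff ℝ ∞ bulkFour :=
  (contDiff_const.sub ((contDiff_sincDeriv 0).pow 2)).add
    ((contDiff_sincDeriv 1).mul contDiff_sineIntegral)

lemma iteratedDeriv_succ_of_hasDerivAt {f g h : ℝ → ℝ} {n : ℕ} (hg : iteratedDeriv n f = g)
    (hh : ∀ x, HasDerivAt g (h x) x) : iteratedDeriv (n + 1) f = h := by
  rw [iteratedDeriv_succ, hg]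
  exact funext fun x => (hh x).deriv

lemma iteratedDeriv_bulkTwo :
    (iteratedDeriv 1 bulkTwo = fun x => -2 * (sincDeriv 0 x * sincDeriv 1 x)) ∧
    (iteratedDeriv 2 bulkTwo = fun x =>
      -2 * (sincDeriv 1 x * sincDeriv 1 x + sincDeriv 0 x * sincDeriv 2 x)) ∧
    (iteratedDeriv 3 bulkTwo = fun x =>
      -2 * (3 * (sincDeriv 1 x * sincDeriv 2 x) + sincDeriv 0 x * sincDeriv 3 x)) := by
  have d := hasDerivAt_sincDeriv
  have h1 := iteratedDeriv_succ_of_hasDerivAt (n := 0) (f := bulkTwo) iteratedDeriv_zero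
    (h := fun x => -2 * (sincDeriv 0 x * sincDeriv 1 x)) fun x =>
      (((d 0 x).fun_pow 2).const_sub 1).congr_deriv (by simp; ring)
  have h2 := iteratedDeriv_succ_of_hasDerivAt h1 (h := fun x =>
      -2 * (sincDeriv 1 x * sincDeriv 1 x + sincDeriv 0 x * sincDeriv 2 x)) fun x =>
      ((d 0 x).fun_mul (d 1 x)).const_mul (-2)
  have h3 := iteratedDeriv_succ_of_hasDerivAt h2 (h := fun x =>
      -2 * (3 * (sincDeriv 1 x * sincDeriv 2 x) + sincDeriv 0 x * sincDeriv 3 x)) fun x =>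
      ((((d 1 x).fun_mul (d 1 x)).fun_add ((d 0 x).fun_mul (d 2 x))).const_mul (-2)).congr_deriv
        (by ring)
  exact ⟨h1, h2, h3⟩

lemma iteratedDeriv_bulkFour :
    (iteratedDeriv 1 bulkFour = fun x =>
      -(sincDeriv 0 x * sincDeriv 1 x) + sincDeriv 2 x * sineIntegral x) ∧
    (iteratedDeriv 2 bulkFour = fun x =>
      -(sincDeriv 1 x * sincDeriv 1 x) + sincDeriv 3 x * sineIntegral x) ∧
    (iteratedDeriv 3 bulkFour = fun x =>
      -2 * (sincDeriv 1 x * sincDeriv 2 x) + sincDeriv 0 x * sincDeriv 3 x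
        + sincDeriv 4 x * sineIntegral x) ∧
    (iteratedDeriv 4 bulkFour = fun x =>
      -2 * (sincDeriv 2 x * sincDeriv 2 x) - sincDeriv 1 x * sincDeriv 3 x
        + 2 * (sincDeriv 0 x * sincDeriv 4 x) + sincDeriv 5 x * sineIntegral x) ∧
    (iteratedDeriv 5 bulkFour = fun x =>
      -5 * (sincDeriv 2 x * sincDeriv 3 x) + sincDeriv 1 x * sincDeriv 4 x
        + 3 * (sincDeriv 0 x * sincDeriv 5 x) + sincDeriv 6 x * sineIntegral x) := by
  have d := hasDerivAt_sincDeriv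
  have J := hasDerivAt_sineIntegral
  have h1 := iteratedDeriv_succ_of_hasDerivAt (n := 0) (f := bulkFour) iteratedDeriv_zero
    (h := fun x => -(sincDeriv 0 x * sincDeriv 1 x) + sincDeriv 2 x * sineIntegral x) fun x =>
      ((((d 0 x).fun_pow 2).const_sub 1).fun_add ((d 1 x).fun_mul (J x))).congr_deriv
        (by simp; ring)
  have h2 := iteratedDeriv_succ_of_hasDerivAt h1 (h := fun x =>
      -(sincDeriv 1 x * sincDeriv 1 x) + sincDeriv 3 x * sineIntegral x) fun x =>
      (((d 0 x).fun_mul (d 1 x)).fun_neg.fun_add ((d 2 x).fun_mul (J x))).congr_deriv (by ring)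
  have h3 := iteratedDeriv_succ_of_hasDerivAt h2 (h := fun x =>
      -2 * (sincDeriv 1 x * sincDeriv 2 x) + sincDeriv 0 x * sincDeriv 3 x
        + sincDeriv 4 x * sineIntegral x) fun x =>
      (((d 1 x).fun_mul (d 1 x)).fun_neg.fun_add ((d 3 x).fun_mul (J x))).congr_deriv (by ring)
  have h4 := iteratedDeriv_succ_of_hasDerivAt h3 (h := fun x =>
      -2 * (sincDeriv 2 x * sincDeriv 2 x) - sincDeriv 1 x * sincDeriv 3 x
        + 2 * (sincDeriv 0 x * sincDeriv 4 x) + sincDeriv 5 x * sineIntegral x) fun x =>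
      (((((d 1 x).fun_mul (d 2 x)).const_mul (-2)).fun_add ((d 0 x).fun_mul (d 3 x))).fun_add
        ((d 4 x).fun_mul (J x))).congr_deriv (by ring)
  have h5 := iteratedDeriv_succ_of_hasDerivAt h4 (h := fun x =>
      -5 * (sincDeriv 2 x * sincDeriv 3 x) + sincDeriv 1 x * sincDeriv 4 x
        + 3 * (sincDeriv 0 x * sincDeriv 5 x) + sincDeriv 6 x * sineIntegral x) fun x =>
      ((((((d 2 x).fun_mul (d 2 x)).const_mul (-2)).fun_sub ((d 1 x).fun_mul (d 3 x))).fun_add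
        (((d 0 x).fun_mul (d 4 x)).const_mul 2)).fun_add
        ((d 5 x).fun_mul (J x))).congr_deriv (by ring)
  exact ⟨h1, h2, h3, h4, h5⟩

lemma bulkTwo_ode (x : ℝ) :
    x ^ 3 * iteratedDeriv 3 bulkTwo x + 4 * x ^ 2 * iteratedDeriv 2 bulkTwo x
      + (4 * x ^ 2 - 2) * x * iteratedDeriv 1 bulkTwo x - 4 * bulkTwo x = 0 := by
  obtain ⟨h1, h2, h3⟩ := iteratedDeriv_bulkTwo
  rw [h1, h2, h3, bulkTwo]
  have q := sincDeriv_sq_relation x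
  have r2 := mul_sincDeriv_two x
  have r3 := mul_sincDeriv_add_three 0 x
  simp only [Nat.cast_zero, zero_add] at r3
  set a := sincDeriv 0 x
  set b := sincDeriv 1 x
  have e2 : x * sincDeriv 2 x = -2 * b - x * a := by linarith
  have e3 : x ^ 2 * sincDeriv 3 x = 6 * b + 2 * x * a - x ^ 2 * b := by
    linear_combination x * r3 - 3 * e2
  have : x ^ 3 * (-2 * (3 * (b * sincDeriv 2 x) + a * sincDeriv 3 x))
      + 4 * x ^ 2 * (-2 * (b * b + a * sincDeriv 2 x))
      + (4 * x ^ 2 - 2) * x * (-2 * (a * b)) - 4 * (1 - a ^ 2)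
      = -6 * x ^ 2 * b * (x * sincDeriv 2 x) - 2 * x * a * (x ^ 2 * sincDeriv 3 x)
      - 8 * x ^ 2 * b * b - 8 * x * a * (x * sincDeriv 2 x)
      + (4 * x ^ 2 - 2) * x * (-2 * (a * b)) - 4 * (1 - a ^ 2) := by ring
  rw [this, e2, e3]
  linear_combination 4 * q

lemma bulkFour_ode (x : ℝ) :
    x ^ 5 * iteratedDeriv 5 bulkFour x + 10 * x ^ 4 * iteratedDeriv 4 bulkFour x
      + (5 * x ^ 5 + 12 * x ^ 3) * iteratedDeriv 3 bulkFour x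
      + (16 * x ^ 4 - 40 * x ^ 2) * iteratedDeriv 2 bulkFour x
      + (4 * x ^ 5 - 12 * x ^ 3 - 16 * x) * iteratedDeriv 1 bulkFour x
      + (-8 * x ^ 2 + 16) * bulkFour x = 0 := by
  obtain ⟨h1, h2, h3, h4, h5⟩ := iteratedDeriv_bulkFour
  rw [h1, h2, h3, h4, h5, bulkFour]
  have q := sincDeriv_sq_relation x
  have r2 := mul_sincDeriv_two x
  have r3 := mul_sincDeriv_add_three 0 x
  have r4 := mul_sincDeriv_add_three 1 x
  have r5 := mul_sincDeriv_add_three 2 x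
  have r6 := mul_sincDeriv_add_three 3 x
  norm_num at r3 r4 r5 r6
  set a := sincDeriv 0 x
  set b := sincDeriv 1 x
  set c := sincDeriv 2 x
  set d := sincDeriv 3 x
  set e := sincDeriv 4 x
  set f := sincDeriv 5 x
  set g := sincDeriv 6 x
  set J := sineIntegral x
  -- `C, D, E, F` stand for `x ^ (k - 1)` times the `k`-th derivative of `sinc`, `k = 2, …, 5`. In
  -- this scaling the recurrence has polynomial coefficients, and no division by `x` occurs.
  obtain ⟨C, hC⟩ : ∃ C, C = -2 * b - x * a := ⟨_, rfl⟩
  obtain ⟨D, hD⟩ : ∃ D, D = -3 * C - x ^ 2 * b - x * a := ⟨_, rfl⟩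
  obtain ⟨E, hE⟩ : ∃ E, E = -4 * D - x ^ 2 * C - 2 * x ^ 2 * b := ⟨_, rfl⟩
  obtain ⟨F, hF⟩ : ∃ F, F = -5 * E - x ^ 2 * D - 3 * x ^ 2 * C := ⟨_, rfl⟩
  have e2 : x * c = C := by linear_combination r2 - hC
  have e3 : x ^ 2 * d = D := by linear_combination x * r3 - 3 * e2 - hD
  have e4 : x ^ 3 * e = E := by linear_combination x ^ 2 * r4 - 4 * e3 - x ^ 2 * e2 - hE
  have e5 : x ^ 4 * f = F := by
    linear_combination x ^ 3 * r5 - 5 * e4 - x ^ 2 * e3 - 3 * x ^ 2 * e2 - hF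
  have e6 : x ^ 5 * g = -6 * F - x ^ 2 * E - 4 * x ^ 2 * D := by
    linear_combination x ^ 4 * r6 - 6 * e5 - x ^ 2 * e4 - 4 * x ^ 2 * e3
  have : x ^ 5 * (-5 * (c * d) + b * e + 3 * (a * f) + g * J)
      + 10 * x ^ 4 * (-2 * (c * c) - b * d + 2 * (a * e) + f * J)
      + (5 * x ^ 5 + 12 * x ^ 3) * (-2 * (b * c) + a * d + e * J)
      + (16 * x ^ 4 - 40 * x ^ 2) * (-(b * b) + d * J)
      + (4 * x ^ 5 - 12 * x ^ 3 - 16 * x) * (-(a * b) + c * J)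
      + (-8 * x ^ 2 + 16) * (1 - a ^ 2 + b * J)
      = -5 * x ^ 2 * (x * c) * (x ^ 2 * d) + x ^ 2 * b * (x ^ 3 * e) + 3 * x * a * (x ^ 4 * f)
      + (x ^ 5 * g) * J - 20 * x ^ 2 * (x * c) ^ 2 - 10 * x ^ 2 * b * (x ^ 2 * d)
      + 20 * x * a * (x ^ 3 * e) + 10 * (x ^ 4 * f) * J
      + (5 * x ^ 2 + 12) * (-2 * x ^ 2 * b * (x * c) + x * a * (x ^ 2 * d) + (x ^ 3 * e) * J)
      + (16 * x ^ 2 - 40) * (-(b * b) * x ^ 2 + (x ^ 2 * d) * J)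
      + (4 * x ^ 4 - 12 * x ^ 2 - 16) * (-(a * b) * x + (x * c) * J)
      + (-8 * x ^ 2 + 16) * (1 - a ^ 2 + b * J) := by ring
  rw [this, e2, e3, e4, e5, e6, hF, hE, hD, hC]
  -- The coefficient of `J` cancels identically: `sinc'` itself solves the equation.
  linear_combination (8 * x ^ 2 - 16) * q

/-! ### Convergence of midpoint sums -/

/-- Midpoint Riemann sums of a continuous function converge to its integral. -/
lemma tendsto_midpoint_sum {g : ℝ → ℝ} (hg : Continuous g) :
    Tendsto (fun N : ℕ => (∑ j ∈ Finset.range N, g (((j : ℝ) + 1 / 2) / N)) / N) atTop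
      (𝓝 (∫ t in (0 : ℝ)..1, g t)) := by
  rw [Metric.tendsto_atTop]
  intro ε hε
  have huc := (isCompact_Icc (a := (0 : ℝ)) (b := 1)).uniformContinuousOn_of_continuous
    hg.continuousOn
  rw [Metric.uniformContinuousOn_iff] at huc
  obtain ⟨δ, hδ, H⟩ := huc (ε / 2) (half_pos hε)
  obtain ⟨N₀, hN₀⟩ := exists_nat_gt (1 / δ)
  refine ⟨N₀ + 1, fun N hN => ?_⟩
  have hNpos : (0 : ℝ) < N := by exact_mod_cast (by omega : 0 < N)
  have hNδ : 1 / (N : ℝ) < δ := by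
    rw [div_lt_comm₀ hNpos hδ]
    exact hN₀.trans (by exact_mod_cast (by omega : N₀ < N))
  have hsum : ∫ t in (0 : ℝ)..1, g t
      = ∑ j ∈ Finset.range N, ∫ t in ((j : ℝ) / N)..((j + 1 : ℕ) : ℝ) / N, g t := by
    rw [intervalIntegral.sum_integral_adjacent_intervals (a := fun j : ℕ => (j : ℝ) / N)
      fun k _ => hg.intervalIntegrable _ _]
    simp [hNpos.ne']
  rw [hsum, Finset.sum_div, dist_eq_norm, ← Finset.sum_sub_distrib]
  have hterm : ∀ j ∈ Finset.range N,
      ‖g (((j : ℝ) + 1 / 2) / N) / N - ∫ t in ((j : ℝ) / N)..((j + 1 : ℕ) : ℝ) / N, g t‖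
        ≤ ε / 2 / N := by
    intro j hj
    have hjN : (j : ℝ) + 1 ≤ N := by exact_mod_cast Finset.mem_range.1 hj
    have hj0 : (0 : ℝ) ≤ j := Nat.cast_nonneg j
    have hlen : ((j + 1 : ℕ) : ℝ) / N - (j : ℝ) / N = 1 / N := by push_cast; ring
    have hconst : g (((j : ℝ) + 1 / 2) / N) / N
        = ∫ t in ((j : ℝ) / N)..((j + 1 : ℕ) : ℝ) / N, g (((j : ℝ) + 1 / 2) / N) := by
      rw [intervalIntegral.integral_const, hlen, smul_eq_mul]; ring
    rw [hconst, ← intervalIntegral.integral_sub (by simp) (hg.intervalIntegrable _ _)]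
    have := intervalIntegral.norm_integral_le_of_norm_le_const
      (a := (j : ℝ) / N) (b := ((j + 1 : ℕ) : ℝ) / N) (C := ε / 2)
      (f := fun t => g (((j : ℝ) + 1 / 2) / N) - g t) ?_
    · rw [hlen, abs_of_pos (by positivity)] at this
      exact this.trans (le_of_eq (by ring))
    · intro t ht
      rw [Set.uIoc_of_le (by gcongr; simp)] at ht
      obtain ⟨ht1, ht2⟩ := ht
      push_cast at ht2
      rw [div_lt_iff₀ hNpos] at ht1
      rw [le_div_iff₀ hNpos] at ht2
      rw [← dist_eq_norm]
      refine (H _ ⟨by positivity, ?_⟩ t ⟨?_, ?_⟩ ?_).le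
      · rw [div_le_one hNpos]; linarith
      · by_contra hneg
        push Not at hneg
        nlinarith
      · by_contra hneg
        push Not at hneg
        nlinarith
      · refine lt_of_le_of_lt ?_ hNδ
        rw [Real.dist_eq, show ((j : ℝ) + 1 / 2) / N - t = ((j : ℝ) + 1 / 2 - t * N) / N by
          field_simp, abs_div, abs_of_pos hNpos]
        gcongr
        rw [abs_le]; constructor <;> linarith
  calc _ ≤ ∑ j ∈ Finset.range N, ε / 2 / N := norm_sum_le_of_le _ hterm
    _ = ε / 2 := by simp; field_simp
    _ < ε := half_lt_self hε

end CircularEnsemble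

namespace CircularEnsemble

open MeasureTheory

/-! ### Integration over the torus and the normalisation -/

lemma integral_angles_prod {n : ℕ} (f : Fin n → ℝ → ℂ) :
    ∫ φ in angles n, ∏ j, f j (φ j) = ∏ j, ∫ t in Set.Ico 0 (2 * Real.pi), f j t := by
  rw [angles, volume_pi, Measure.restrict_pi_pi, integral_fintype_prod_eq_prod]

lemma integral_exp_int_mul (m : ℤ) :
    ∫ t in Set.Ico 0 (2 * Real.pi), Complex.exp (Complex.I * (m * (t : ℂ)))
      = if m = 0 then (2 * Real.pi : ℂ) else 0 := by
  rw [integral_Ico_eq_integral_Ioc, ← intervalIntegral.integral_of_le Real.two_pi_pos.le]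
  split_ifs with h
  · simp [h]
  · have hc : Complex.I * m ≠ 0 := mul_ne_zero Complex.I_ne_zero (by exact_mod_cast h)
    simp_rw [← mul_assoc]
    rw [integral_exp_mul_complex hc]
    have : Complex.exp (Complex.I * m * ((2 * Real.pi : ℝ) : ℂ)) = 1 := by
      rw [Complex.exp_eq_one_iff]
      exact ⟨m, by push_cast; ring⟩
    rw [this]
    simp

lemma integrableOn_angles {n : ℕ} {E : Type*} [NormedAddCommGroup E] {w : (Fin n → ℝ) → E}
    (hw : Continuous w) : IntegrableOn w (angles n) := by
  refine (hw.continuousOn.integrableOn_compact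
    (isCompact_univ_pi fun _ : Fin n => isCompact_Icc (a := (0 : ℝ)) (b := 2 * Real.pi))).mono_set ?_
  exact Set.pi_mono fun _ _ => Set.Ico_subset_Icc_self

lemma integral_angles_succ {n : ℕ} {w : (Fin (n + 1) → ℝ) → ℝ} (hw : Continuous w) :
    ∫ θ in angles (n + 1), w θ
      = ∫ t in Set.Ico 0 (2 * Real.pi), ∫ φ in angles n, w (Matrix.vecCons t φ) := by
  set e : ℝ × (Fin n → ℝ) ≃ᵐ (Fin (n + 1) → ℝ) :=
    (MeasurableEquiv.piFinSuccAbove (fun _ => ℝ) 0).symm with he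
  have hem : MeasurePreserving e :=
    (volume_preserving_piFinSuccAbove (fun _ : Fin (n + 1) => ℝ) 0).symm _
  have hap : ∀ x : ℝ × (Fin n → ℝ), e x = Matrix.vecCons x.1 x.2 := by
    intro x
    simp [he, MeasurableEquiv.piFinSuccAbove_symm_apply, Fin.insertNthEquiv, Matrix.vecCons]
  have hpre : e ⁻¹' angles (n + 1) = Set.Ico 0 (2 * Real.pi) ×ˢ angles n := by
    ext x
    simp only [Set.mem_preimage, hap, angles, Set.mem_univ_pi, Set.mem_prod, Fin.forall_fin_succ,
      Matrix.cons_val_zero, Matrix.cons_val_succ]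
  have hint := (hem.integrableOn_comp_preimage e.measurableEmbedding).2 (integrableOn_angles hw)
  rw [← hem.setIntegral_preimage_emb e.measurableEmbedding, hpre, Measure.volume_eq_prod,
    setIntegral_prod]
  · simp only [hap]
  · rw [hpre] at hint
    exact hint

lemma continuous_weight {β : ℝ} (hβ : 0 ≤ β) {N : ℕ} :
    Continuous fun θ : Fin N → ℝ => weight β θ := by
  unfold weight
  refine continuous_finsetProd _ fun j _ => continuous_finsetProd _ fun k _ => ?_
  refine Continuous.rpow_const ?_ fun _ => Or.inr hβ
  fun_prop

lemma integral_cos_int_mul_sub {m : ℤ} (hm : m ≠ 0) (s : ℝ) :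
    ∫ t in Set.Ico 0 (2 * Real.pi), Real.cos (m * (s - t)) = 0 := by
  have hm' : (m : ℝ) ≠ 0 := by exact_mod_cast hm
  rw [integral_Ico_eq_integral_Ioc, ← intervalIntegral.integral_of_le Real.two_pi_pos.le]
  have h := intervalIntegral.integral_comp_sub_mul (a := 0) (b := 2 * Real.pi) Real.cos hm' (m * s)
  simp_rw [mul_sub]
  rw [h, integral_cos, mul_zero, sub_zero]
  have := Real.sin_periodic.int_mul m (m * s - m * (2 * Real.pi))
  rw [sub_add_cancel] at this
  rw [this, sub_self, smul_zero]

/-- The two-point function is determined by the shape of the partially integrated weight: its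
normalisation is forced by the constant Fourier coefficient. -/
lemma twoPoint_eq_of_partial_integral {β : ℝ} (hβ : 0 ≤ β) (n : ℕ) {C : ℝ} (hC : C ≠ 0)
    (u v : Fin (n + 2) × Fin (n + 2) → ℝ) (m l : Fin (n + 2) × Fin (n + 2) → ℤ)
    (hm : ∀ x, x.1 ≠ x.2 → m x ≠ 0) (hl : ∀ x, x.1 ≠ x.2 → l x ≠ 0)
    (hG : ∀ s t : ℝ, ∫ φ in angles n, weight β (Matrix.vecCons s (Matrix.vecCons t φ))
      = C * ∑ x ∈ (Finset.univ : Finset (Fin (n + 2))).offDiag,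
        (1 + u x * Real.cos (m x * (s - t)) + v x * Real.cos (l x * (s - t)))) (s t : ℝ) :
    twoPoint β (n + 2) s t = (∑ x ∈ (Finset.univ : Finset (Fin (n + 2))).offDiag,
        (1 + u x * Real.cos (m x * (s - t)) + v x * Real.cos (l x * (s - t))))
          / (2 * Real.pi) ^ 2 := by
  have hi : ∀ {f : ℝ → ℝ}, Continuous f → IntegrableOn f (Set.Ico 0 (2 * Real.pi)) := fun hf =>
    (hf.integrableOn_Icc).mono_set Set.Ico_subset_Icc_self
  -- Every cosine integrates to zero over its full periods, so only the number `(n + 2)(n + 1)` of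
  -- ordered pairs remains.
  have hin : ∀ s : ℝ, ∫ t in Set.Ico 0 (2 * Real.pi),
      ∑ x ∈ (Finset.univ : Finset (Fin (n + 2))).offDiag,
        (1 + u x * Real.cos (m x * (s - t)) + v x * Real.cos (l x * (s - t)))
      = ((n : ℝ) + 2) * ((n : ℝ) + 1) * (2 * Real.pi) := by
    intro s
    rw [integral_finsetSum _ fun x _ => hi (by fun_prop)]
    have : ∀ x ∈ (Finset.univ : Finset (Fin (n + 2))).offDiag,
        ∫ t in Set.Ico 0 (2 * Real.pi),
          (1 + u x * Real.cos (m x * (s - t)) + v x * Real.cos (l x * (s - t)))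
        = 2 * Real.pi := by
      intro x hx
      have hx' := (Finset.mem_offDiag.1 hx).2.2
      rw [integral_add (hi (by fun_prop)) (hi (by fun_prop)),
        integral_add (hi (by fun_prop)) (hi (by fun_prop)), integral_const_mul,
        integral_const_mul, integral_cos_int_mul_sub (hm x hx'),
        integral_cos_int_mul_sub (hl x hx')]
      simp [Real.pi_pos.le]
    rw [Finset.sum_congr rfl this, Finset.sum_const, Finset.offDiag_card]
    have hcard : (Finset.univ : Finset (Fin (n + 2))).card * (Finset.univ : Finset (Fin (n + 2))).card
        - (Finset.univ : Finset (Fin (n + 2))).card = (n + 2) * (n + 1) := by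
      rw [Finset.card_univ, Fintype.card_fin, ← Nat.mul_sub_one]; rfl
    rw [hcard, nsmul_eq_mul]
    push_cast
    ring
  -- The inner integral no longer depends on `s`, so the outer one contributes `2π`. The factor `(n
  -- + 2)(n + 1)` will cancel the prefactor of `twoPoint`, and `C` drops out.
  have hZ : normalisation (n + 2) β
      = C * (((n : ℝ) + 2) * ((n : ℝ) + 1) * (2 * Real.pi) ^ 2) := by
    have hw := continuous_weight hβ (N := n + 2)
    rw [normalisation, integral_angles_succ hw]
    have : ∀ s : ℝ, ∫ φ in angles (n + 1), weight β (Matrix.vecCons s φ)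
        = C * (((n : ℝ) + 2) * ((n : ℝ) + 1) * (2 * Real.pi)) := by
      intro s
      have hc : Continuous fun φ : Fin (n + 1) → ℝ => weight β (Matrix.vecCons s φ) :=
        hw.comp (continuous_const.matrixVecCons continuous_id)
      rw [integral_angles_succ hc]
      simp_rw [hG]
      rw [integral_const_mul, hin]
    simp_rw [this]
    simp [Real.pi_pos.le]
    ring
  have hn : ((n : ℝ) + 2) * ((n : ℝ) + 1) ≠ 0 := by positivity
  have hpi : (2 * Real.pi) ^ 2 ≠ 0 := by positivity
  simp only [twoPoint, density]
  rw [integral_div, hG, hZ]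
  generalize (Finset.sum _ _ : ℝ) = K
  field_simp

end CircularEnsemble

namespace CircularEnsemble

open MeasureTheory Equiv

/-! ### Permutations and their restrictions -/

section Permutations

variable {n : ℕ}

lemma exists_perm_extending {k m : ℕ} {e c : Fin k → Fin m} (he : Function.Injective e)
    (hc : Function.Injective c) : ∃ π : Perm (Fin m), ∀ j, π (e j) = c j := by
  obtain ⟨g, hg⟩ := (Perm.isMultiplyPretransitive (Fin m) k).exists_smul_eq
    ⟨e, he⟩ ⟨c, hc⟩
  exact ⟨g, fun j => by simpa using DFunLike.congr_fun hg j⟩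

lemma succ_succ_injective : Function.Injective fun j : Fin n => j.succ.succ :=
  (Fin.succ_injective _).comp (Fin.succ_injective _)

/-- The quotient `π⁻¹ * π'` fixes every index from `2` on, hence permutes `{0, 1}`. -/
lemma perm_eq_or_eq_mul_swap {π π' : Perm (Fin (n + 2))}
    (h : ∀ j : Fin n, π' j.succ.succ = π j.succ.succ) : π' = π ∨ π' = π * swap 0 1 := by
  have key : ∀ σ : Perm (Fin (n + 2)), (∀ j : Fin n, σ j.succ.succ = j.succ.succ) →
      σ = 1 ∨ σ = swap 0 1 := by
    intro σ hσ
    have hmem : ∀ i : Fin (n + 2), (∀ j : Fin n, i ≠ j.succ.succ) → i = 0 ∨ i = 1 := by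
      intro i
      refine Fin.cases (fun _ => Or.inl rfl) (fun i => ?_) i
      refine Fin.cases (fun _ => Or.inr rfl) (fun i hi => absurd rfl (hi i)) i
    have hne : ∀ i : Fin (n + 2), (i = 0 ∨ i = 1) → σ i = 0 ∨ σ i = 1 := by
      intro i hi
      refine hmem _ fun j hj => ?_
      rw [← hσ j] at hj
      rcases hi with rfl | rfl
      · exact absurd (σ.injective hj) (Fin.succ_ne_zero _).symm
      · have h1 : (0 : Fin (n + 1)).succ = j.succ.succ := σ.injective hj
        exact absurd (Fin.succ_injective _ h1) (Fin.succ_ne_zero _).symm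
    have h01 : σ 0 ≠ σ 1 := fun h => absurd (σ.injective h) Fin.zero_ne_one
    have hss : ∀ j : Fin n, swap (0 : Fin (n + 2)) 1 j.succ.succ = j.succ.succ := fun j =>
      swap_apply_of_ne_of_ne (Fin.succ_ne_zero _)
        fun h => Fin.succ_ne_zero _ (Fin.succ_injective _ h)
    rcases hne 0 (Or.inl rfl) with h0 | h0
    · left
      have h1 : σ 1 = 1 := (hne 1 (Or.inr rfl)).resolve_left fun h => h01 (h0.trans h.symm)
      ext1 i
      refine Fin.cases h0 (fun i => ?_) i
      refine Fin.cases h1 hσ i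
    · right
      have h1 : σ 1 = 0 := (hne 1 (Or.inr rfl)).resolve_right fun h => h01 (h0.trans h.symm)
      ext1 i
      refine Fin.cases (by simpa using h0) (fun i => ?_) i
      refine Fin.cases (by simpa using h1) (fun j => ?_) i
      rw [hσ, hss]
  rcases key (π⁻¹ * π') fun j => by simp [h] with h1 | h1
  · left
    rw [inv_mul_eq_one] at h1
    exact h1.symm
  · right
    rw [← h1, mul_inv_cancel_left]

lemma mul_swap_zero_one_succ_succ (π : Perm (Fin (n + 2))) (j : Fin n) :
    (π * swap 0 1 : Perm (Fin (n + 2))) j.succ.succ = π j.succ.succ := by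
  rw [Perm.mul_apply]
  exact congrArg π (swap_apply_of_ne_of_ne (Fin.succ_ne_zero _)
    fun h => Fin.succ_ne_zero _ (Fin.succ_injective _ h))

lemma ne_mul_swap_zero_one (π : Perm (Fin (n + 2))) : π ≠ π * swap 0 1 := by
  intro h
  have := congrArg (fun σ : Perm (Fin (n + 2)) => σ 0) h
  simp at this

lemma filter_perm_eq_pair (π : Perm (Fin (n + 2))) :
    (Finset.univ.filter fun π' : Perm (Fin (n + 2)) => ∀ j : Fin n,
      π' j.succ.succ = π j.succ.succ) = {π, π * swap 0 1} := by
  ext π'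
  simp only [Finset.mem_filter, Finset.mem_univ, true_and, Finset.mem_insert,
    Finset.mem_singleton]
  refine ⟨perm_eq_or_eq_mul_swap, ?_⟩
  rintro (rfl | rfl) j
  · rfl
  · exact mul_swap_zero_one_succ_succ π j

/-- Each injection `Fin n → Fin (n + 2)` is the restriction of exactly two permutations. -/
lemma sum_perm_restrict (g : (Fin n → Fin (n + 2)) → ℂ)
    (hg : ∀ c, ¬ Function.Injective c → g c = 0) :
    ∑ π : Perm (Fin (n + 2)), g (fun j => π j.succ.succ) = 2 * ∑ c, g c := by
  rw [← Finset.sum_fiberwise (s := Finset.univ)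
    (g := fun (π : Perm (Fin (n + 2))) (j : Fin n) => π j.succ.succ), Finset.mul_sum]
  refine Finset.sum_congr rfl fun c _ => ?_
  by_cases hc : Function.Injective c
  · obtain ⟨π, hπ⟩ := exists_perm_extending succ_succ_injective hc
    have : (Finset.univ.filter fun π' : Perm (Fin (n + 2)) =>
        (fun j : Fin n => π' j.succ.succ) = c) = {π, π * swap 0 1} := by
      rw [← filter_perm_eq_pair]
      refine Finset.filter_congr fun π' _ => ?_
      rw [funext_iff]
      simp only [hπ]
    rw [this, Finset.sum_pair (ne_mul_swap_zero_one π)]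
    simp only [mul_swap_zero_one_succ_succ, hπ]
    ring
  · rw [hg c hc, mul_zero]
    refine Finset.sum_eq_zero fun π hπ => ?_
    rw [(Finset.mem_filter.1 hπ).2, hg c hc]

/-- Summing a function of the images of `0` and `1` over all permutations. -/
lemma exists_sum_perm_zero_one (n : ℕ) : ∃ m : ℕ, m ≠ 0 ∧
    ∀ h : Fin (n + 2) × Fin (n + 2) → ℂ, ∑ π : Perm (Fin (n + 2)), h (π 0, π 1)
      = m * ∑ x ∈ (Finset.univ : Finset (Fin (n + 2))).offDiag, h x := by
  refine ⟨(Finset.univ.filter fun π : Perm (Fin (n + 2)) => (π 0, π 1) = (0, 1)).card,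
    Finset.card_ne_zero.2 ⟨1, by simp⟩, fun h => ?_⟩
  rw [← Finset.sum_fiberwise_of_maps_to (s := Finset.univ)
    (t := (Finset.univ : Finset (Fin (n + 2))).offDiag)
    (g := fun π : Perm (Fin (n + 2)) => (π 0, π 1)) (by simp), Finset.mul_sum]
  refine Finset.sum_congr rfl fun x hx => ?_
  have hx' := (Finset.mem_offDiag.1 hx).2.2
  obtain ⟨ρ, hρ⟩ := exists_perm_extending (m := n + 2) (e := ![0, 1]) (c := ![x.1, x.2])
    (by intro i j; fin_cases i <;> fin_cases j <;> simp)
    (by intro i j; fin_cases i <;> fin_cases j <;> simp [hx', hx'.symm])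
  have h0 : ρ 0 = x.1 := hρ 0
  have h1 : ρ 1 = x.2 := hρ 1
  rw [Finset.sum_congr rfl (g := fun _ => h x) fun π hπ => by rw [(Finset.mem_filter.1 hπ).2],
    Finset.sum_const, nsmul_eq_mul]
  congr 2
  -- Left multiplication by `ρ` carries the permutations fixing `0` and `1` onto those sending `(0,
  -- 1)` to `x`, so all fibres have the same size.
  refine (Finset.card_equiv (Equiv.mulLeft ρ) fun π => ?_).symm
  simp only [Finset.mem_filter, Finset.mem_univ, true_and, coe_mulLeft, Perm.mul_apply,
    Prod.ext_iff, ← h0, ← h1, EmbeddingLike.apply_eq_iff_eq]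

end Permutations

/-! ### The partial integral at `β = 2` -/

/-- The weight is the Vandermonde determinant times its conjugate. Conjugation inverts points of the
unit circle, so expanding both factors gives the frequencies `σ j - τ j`. -/
lemma weight_two_eq_sum {N : ℕ} (θ : Fin N → ℝ) :
    (weight 2 θ : ℂ) = ∑ σ : Perm (Fin N), ∑ τ : Perm (Fin N),
      ((Perm.sign σ : ℤ) : ℂ) * ((Perm.sign τ : ℤ) : ℂ) *
        ∏ j, Complex.exp (Complex.I * ((((σ j : ℕ) : ℤ) - ((τ j : ℕ) : ℤ) : ℤ) * (θ j : ℂ))) := by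
  set z : Fin N → ℂ := fun j => Complex.exp (Complex.I * (θ j : ℂ)) with hz
  have hdet : (Matrix.vandermonde z).det
      = ∑ σ : Perm (Fin N), ((Perm.sign σ : ℤ) : ℂ) * ∏ j, z j ^ (σ j : ℕ) := by
    rw [← Matrix.det_transpose, Matrix.det_apply']
    rfl
  have hconj : ∀ j, (starRingEnd ℂ) (z j) = Complex.exp (-(Complex.I * (θ j : ℂ))) := by
    intro j
    rw [hz, ← Complex.exp_conj]
    simp
  have hw : (weight 2 θ : ℂ)
      = (Matrix.vandermonde z).det * (starRingEnd ℂ) (Matrix.vandermonde z).det := by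
    rw [Complex.mul_conj', Matrix.det_vandermonde, ← Complex.ofReal_pow]
    congr 1
    simp only [weight, norm_prod, ← Finset.prod_pow, Real.rpow_ofNat, hz]
  rw [hw, hdet, map_sum, Finset.sum_mul_sum]
  refine Finset.sum_congr rfl fun σ _ => Finset.sum_congr rfl fun τ _ => ?_
  rw [map_mul, map_prod, map_intCast, mul_mul_mul_comm, ← Finset.prod_mul_distrib]
  congr 1
  refine Finset.prod_congr rfl fun j _ => ?_
  rw [map_pow, hconj, hz, ← Complex.exp_nat_mul, ← Complex.exp_nat_mul, ← Complex.exp_add]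
  congr 1
  push_cast
  ring

/-- Orthogonality forces `τ = σ` from index `2` on, so `τ` is `σ` or `σ * swap 0 1`. The first
contributes `1`, the second, of opposite sign, minus an exponential in `s - t`; taking real parts
leaves the cosine. -/
lemma integral_weight_two (n : ℕ) : ∃ C : ℝ, C ≠ 0 ∧ ∀ s t : ℝ,
    ∫ φ in angles n, weight 2 (Matrix.vecCons s (Matrix.vecCons t φ))
      = C * ∑ x ∈ (Finset.univ : Finset (Fin (n + 2))).offDiag,
        (1 - Real.cos ((((x.1 : ℕ) : ℤ) - ((x.2 : ℕ) : ℤ) : ℤ) * (s - t))) := by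
  obtain ⟨m, hm, hsum⟩ := exists_sum_perm_zero_one n
  refine ⟨(2 * Real.pi) ^ n * m, by positivity, fun s t => ?_⟩
  have hint : ((∫ φ in angles n, weight 2 (Matrix.vecCons s (Matrix.vecCons t φ)) : ℝ) : ℂ)
      = ∑ σ : Perm (Fin (n + 2)), ∑ τ : Perm (Fin (n + 2)),
        (if ∀ j : Fin n, τ j.succ.succ = σ j.succ.succ then
          ((Perm.sign σ : ℤ) : ℂ) * ((Perm.sign τ : ℤ) : ℂ) *
          (Complex.exp (Complex.I * ((((σ 0 : ℕ) : ℤ) - ((τ 0 : ℕ) : ℤ) : ℤ) * (s : ℂ)))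
          * Complex.exp (Complex.I * ((((σ 1 : ℕ) : ℤ) - ((τ 1 : ℕ) : ℤ) : ℤ) * (t : ℂ))))
          * (2 * Real.pi) ^ n else 0) := by
    rw [← integral_complex_ofReal]
    simp_rw [weight_two_eq_sum]
    rw [integral_finsetSum]
    swap
    · exact fun σ _ => integrableOn_angles (by fun_prop)
    refine Finset.sum_congr rfl fun σ _ => ?_
    rw [integral_finsetSum]
    swap
    · exact fun τ _ => integrableOn_angles (by fun_prop)
    refine Finset.sum_congr rfl fun τ _ => ?_
    simp_rw [Fin.prod_univ_succ]
    simp only [Matrix.cons_val_zero, Matrix.cons_val_succ]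
    simp only [Fin.succ_zero_eq_one]
    rw [integral_const_mul, integral_const_mul, integral_const_mul]
    rw [integral_angles_prod fun (j : Fin n) (x : ℝ) => Complex.exp (Complex.I *
      ((((σ j.succ.succ : ℕ) : ℤ) - ((τ j.succ.succ : ℕ) : ℤ) : ℤ) * (x : ℂ)))]
    simp_rw [integral_exp_int_mul]
    have hiff : ∀ j : Fin n, (((σ j.succ.succ : ℕ) : ℤ) - ((τ j.succ.succ : ℕ) : ℤ) = 0)
        ↔ τ j.succ.succ = σ j.succ.succ := by
      intro j
      rw [sub_eq_zero, Nat.cast_inj, Fin.val_inj, eq_comm]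
    simp_rw [hiff, Finset.prod_ite_zero]
    simp only [Finset.mem_univ, true_implies, Finset.prod_const, Finset.card_univ,
      Fintype.card_fin]
    split_ifs
    · ring
    · simp
  set h : Fin (n + 2) × Fin (n + 2) → ℂ := fun x => (2 * (Real.pi : ℂ)) ^ n *
    (1 - Complex.exp (((((x.1 : ℕ) : ℤ) - ((x.2 : ℕ) : ℤ) : ℤ) * (s - t) : ℝ) * Complex.I)) with hh
  have hσ : ∀ σ : Perm (Fin (n + 2)), ∑ τ : Perm (Fin (n + 2)),
        (if ∀ j : Fin n, τ j.succ.succ = σ j.succ.succ then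
          ((Perm.sign σ : ℤ) : ℂ) * ((Perm.sign τ : ℤ) : ℂ) *
          (Complex.exp (Complex.I * ((((σ 0 : ℕ) : ℤ) - ((τ 0 : ℕ) : ℤ) : ℤ) * (s : ℂ)))
          * Complex.exp (Complex.I * ((((σ 1 : ℕ) : ℤ) - ((τ 1 : ℕ) : ℤ) : ℤ) * (t : ℂ))))
          * (2 * Real.pi) ^ n else 0)
      = h (σ 0, σ 1) := by
    intro σ
    simp only [hh]
    rw [← Finset.sum_filter, filter_perm_eq_pair, Finset.sum_pair (ne_mul_swap_zero_one σ)]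
    have hs : ((Perm.sign σ : ℤ) : ℂ) * ((Perm.sign σ : ℤ) : ℂ) = 1 := by
      rw [← Int.cast_mul, ← Units.val_mul, Int.units_mul_self]
      simp
    rw [Perm.sign_mul, Perm.sign_swap Fin.zero_ne_one]
    simp only [Perm.mul_apply, swap_apply_left, swap_apply_right, sub_self, Int.cast_zero,
      zero_mul, mul_zero, Complex.exp_zero, Units.val_mul, Units.val_neg, Units.val_one,
      Int.cast_mul, Int.cast_neg, Int.cast_one]
    rw [← Complex.exp_add, show Complex.I * ((((σ 0 : ℕ) : ℤ) - ((σ 1 : ℕ) : ℤ) : ℤ) * (s : ℂ))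
      + Complex.I * ((((σ 1 : ℕ) : ℤ) - ((σ 0 : ℕ) : ℤ) : ℤ) * (t : ℂ))
      = ((((σ 0 : ℕ) : ℤ) - ((σ 1 : ℕ) : ℤ) : ℤ) * (s - t) : ℝ) * Complex.I by
        push_cast; ring]
    linear_combination ((2 * (Real.pi : ℂ)) ^ n *
      (1 - Complex.exp (((((σ 0 : ℕ) : ℤ) - ((σ 1 : ℕ) : ℤ) : ℤ) * (s - t) : ℝ) * Complex.I))) * hs
  have hre := congrArg Complex.re
    (hint.trans ((Finset.sum_congr rfl fun σ _ => hσ σ).trans (hsum h)))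
  simp only [hh] at hre
  rw [Complex.ofReal_re] at hre
  rw [hre, ← Finset.mul_sum, ← mul_assoc,
    show (m : ℂ) * (2 * (Real.pi : ℂ)) ^ n = (((2 * Real.pi) ^ n * m : ℝ) : ℂ) by
      push_cast; ring, Complex.re_ofReal_mul, Complex.re_sum]
  simp only [Complex.sub_re, Complex.one_re, Complex.exp_ofReal_mul_I_re]

/-! ### The weight at `β = 4` as a confluent Vandermonde determinant -/

/-- The frequencies `±1/2, ±3/2, …, ±(N - 1/2)`. -/
noncomputable def freq {N : ℕ} (x : Fin 2 × Fin N) : ℝ :=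
  if x.1 = 0 then -((x.2 : ℝ) + 1 / 2) else (x.2 : ℝ) + 1 / 2

/-- The confluent Vandermonde matrix, with rows `exp (i p θ_j)` and `p exp (i p θ_j)` and columns
indexed by the frequencies `p`. -/
noncomputable def confluent {N : ℕ} (θ : Fin N → ℝ) :
    Matrix (Fin 2 × Fin N) (Fin 2 × Fin N) ℂ :=
  Matrix.of fun y x => (if y.1 = 0 then 1 else (freq x : ℂ)) *
    Complex.exp (Complex.I * ((freq x : ℂ) * (θ y.2 : ℂ)))

/-- The chord `e^{iu/2} - e^{-iu/2}`. -/
noncomputable def chord (u : ℝ) : ℂ := 2 * Complex.I * (Real.sin (u / 2) : ℂ)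

lemma exp_sub_exp_eq_chord (a b : ℝ) :
    Complex.exp (Complex.I * (a : ℂ)) - Complex.exp (Complex.I * (b : ℂ))
      = Complex.exp (Complex.I * ((b : ℂ) + a) / 2) * chord (a - b) := by
  have h1 : Complex.exp (Complex.I * (a : ℂ)) = Complex.exp (Complex.I * ((b : ℂ) + a) / 2)
      * Complex.exp (((a - b) / 2 : ℂ) * Complex.I) := by
    rw [← Complex.exp_add]; ring_nf
  have h2 : Complex.exp (Complex.I * (b : ℂ)) = Complex.exp (Complex.I * ((b : ℂ) + a) / 2)
      * Complex.exp (-((a - b) / 2 : ℂ) * Complex.I) := by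
    rw [← Complex.exp_add]; ring_nf
  have h3 : chord (a - b) = Complex.exp (((a - b) / 2 : ℂ) * Complex.I)
      - Complex.exp (-((a - b) / 2 : ℂ) * Complex.I) := by
    have := Complex.two_sin (((a - b : ℝ) : ℂ) / 2)
    rw [chord, Complex.ofReal_sin]
    push_cast at this ⊢
    linear_combination Complex.I * this + (Complex.exp (-((a - b) / 2 : ℂ) * Complex.I)
      - Complex.exp (((a - b) / 2 : ℂ) * Complex.I)) * Complex.I_mul_I
  rw [h1, h2, h3, mul_sub]

/-- The phase has modulus one, and the fourth power removes both `i` and the sign of the sine, so no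
conjugates are needed. -/
lemma norm_exp_sub_exp_pow_four (a b : ℝ) :
    ((‖Complex.exp (Complex.I * (a : ℂ)) - Complex.exp (Complex.I * (b : ℂ))‖ ^ (4 : ℝ) : ℝ) : ℂ)
      = chord (a - b) ^ 4 := by
  have : ‖Complex.exp (Complex.I * ((b : ℂ) + a) / 2)‖ = 1 := by
    rw [show Complex.I * ((b : ℂ) + a) / 2 = (((b + a) / 2 : ℝ) : ℂ) * Complex.I by
      push_cast; ring, Complex.norm_exp_ofReal_mul_I]
  rw [exp_sub_exp_eq_chord, norm_mul, this, one_mul, chord, norm_mul, norm_mul, Complex.norm_I,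
    Complex.norm_real, Real.rpow_ofNat, mul_pow, mul_pow, mul_pow, mul_pow, Complex.I_pow_four,
    Real.norm_eq_abs, Even.pow_abs (by decide)]
  norm_num

/-- The Vandermonde determinant in symmetric form. -/
lemma det_exp_centered (M : ℕ) (φ : Fin M → ℝ) :
    (Matrix.of fun (i k : Fin M) => Complex.exp
      (Complex.I * ((((k : ℝ) - ((M : ℝ) - 1) / 2 : ℝ) : ℂ) * (φ i : ℂ)))).det
      = ∏ i, ∏ k ∈ Finset.Ioi i, chord (φ k - φ i) := by
  have hmat : (Matrix.of fun (i k : Fin M) => Complex.exp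
      (Complex.I * ((((k : ℝ) - ((M : ℝ) - 1) / 2 : ℝ) : ℂ) * (φ i : ℂ))))
      = Matrix.of fun i k => Complex.exp (-(Complex.I * (((M : ℂ) - 1) * φ i) / 2)) *
        Matrix.vandermonde (fun i => Complex.exp (Complex.I * (φ i : ℂ))) i k := by
    ext i k
    simp only [Matrix.of_apply, Matrix.vandermonde_apply]
    rw [← Complex.exp_nat_mul, ← Complex.exp_add]
    congr 1
    push_cast
    ring
  rw [hmat, Matrix.det_mul_column, Matrix.det_vandermonde]
  simp_rw [exp_sub_exp_eq_chord, Finset.prod_mul_distrib]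
  rw [← mul_assoc]
  simp_rw [← Complex.exp_sum]
  rw [← Complex.exp_add]
  -- Each angle lies in `M - 1` pairs, so the half-angle phases of all chords cancel the row factors
  -- produced by centring the exponents.
  have hsum : ∑ i, ∑ k ∈ Finset.Ioi i, Complex.I * ((φ i : ℂ) + φ k) / 2
      = ∑ i, Complex.I * (((M : ℂ) - 1) * φ i) / 2 := by
    have h := Finset.sum_sum_Ioi_add_eq_sum_sum_off_diag
      (fun _ i : Fin M => Complex.I * (φ i : ℂ) / 2)
    simp only [Finset.sum_const, Finset.card_compl, Finset.card_singleton, Fintype.card_fin] at h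
    calc _ = ∑ i, ∑ k ∈ Finset.Ioi i, (Complex.I * (φ i : ℂ) / 2 + Complex.I * (φ k : ℂ) / 2) := by
          refine Finset.sum_congr rfl fun i _ => Finset.sum_congr rfl fun k _ => ?_
          ring
      _ = _ := h
      _ = _ := by
          refine Finset.sum_congr rfl fun i _ => ?_
          rw [nsmul_eq_mul, Nat.cast_sub (by have := i.pos; omega)]
          push_cast
          ring
  rw [hsum, Finset.sum_neg_distrib, neg_add_cancel, Complex.exp_zero, one_mul]

/-- The rows `(0, j)` and `(1, j)` as consecutive elements of `Fin (N * 2)`. -/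
def rowEquiv (N : ℕ) : Fin 2 × Fin N ≃ Fin (N * 2) :=
  (Equiv.prodComm _ _).trans finProdFinEquiv

/-- With rows interleaved as `a + 2 * j`, a pair `j < k` yields four differences, all of the form
later minus earlier, and each `j` alone yields one factor `S h`. No signs arise. -/
lemma prod_rowEquiv_pairs (N : ℕ) (S : ℝ → ℂ) (θ : Fin N → ℝ) (h : ℝ) (φ : Fin (N * 2) → ℝ)
    (hφ : ∀ x, φ (rowEquiv N x) = θ x.2 + (x.1 : ℝ) * h) :
    ∏ i, ∏ k ∈ Finset.Ioi i, S (φ k - φ i)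
      = S h ^ N * ∏ j, ∏ k ∈ Finset.Ioi j, (S (θ k - θ j) ^ 2 * S (θ k - θ j + h)
        * S (θ k - θ j - h)) := by
  have hIoi : ∀ {M : ℕ} (F : Fin M → Fin M → ℂ), ∏ i, ∏ k ∈ Finset.Ioi i, F i k
      = ∏ i, ∏ k, if i < k then F i k else 1 := by
    intro M F
    refine Finset.prod_congr rfl fun i _ => ?_
    rw [← Finset.prod_filter, Finset.filter_lt_eq_Ioi]
  rw [hIoi, hIoi, ← (rowEquiv N).prod_comp]
  simp_rw [← (rowEquiv N).prod_comp (fun k => ite _ _ _)]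
  have hlt : ∀ x y, rowEquiv N x < rowEquiv N y ↔ (x.1 : ℕ) + 2 * x.2 < y.1 + 2 * y.2 :=
    fun _ _ => Iff.rfl
  simp_rw [hφ]
  rw [Fintype.prod_prod_type_right]
  have hN : S h ^ N = ∏ _j : Fin N, S h := by simp
  rw [hN, ← Finset.prod_mul_distrib]
  refine Finset.prod_congr rfl fun j _ => ?_
  -- Spreading `S h` over `k` makes both sides products over all `(j, k)`, to be compared factor by
  -- factor.
  have hh : S h = ∏ k : Fin N, if k = j then S h else 1 := by simp
  rw [hh, ← Finset.prod_mul_distrib]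
  simp_rw [Fintype.prod_prod_type_right]
  rw [← Finset.prod_comm]
  refine Finset.prod_congr rfl fun k _ => ?_
  simp only [Fin.prod_univ_two]
  rcases lt_trichotomy j k with hjk | hjk | hjk
  · have h1 : k ≠ j := fun h => by simp [h] at hjk
    have e1 : rowEquiv N (0, j) < rowEquiv N (0, k) := by rw [hlt]; simp; omega
    have e2 : rowEquiv N (0, j) < rowEquiv N (1, k) := by rw [hlt]; simp; omega
    have e3 : rowEquiv N (1, j) < rowEquiv N (0, k) := by rw [hlt]; simp; omega
    have e4 : rowEquiv N (1, j) < rowEquiv N (1, k) := by rw [hlt]; simp; omega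
    rw [if_pos e1, if_pos e2, if_pos e3, if_pos e4, if_neg h1, if_pos hjk]
    simp only [Fin.val_zero, Fin.val_one, Nat.cast_zero, Nat.cast_one, zero_mul, one_mul, add_zero]
    rw [show θ k + h - θ j = θ k - θ j + h by ring, show θ k - (θ j + h) = θ k - θ j - h by ring,
      show θ k + h - (θ j + h) = θ k - θ j by ring]
    ring
  · have h1 : k = j := hjk.symm
    subst h1
    simp [hlt]
  · have h1 : k ≠ j := fun h => by simp [h] at hjk
    have e1 : ¬ rowEquiv N (0, j) < rowEquiv N (0, k) := by rw [hlt]; simp; omega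
    have e2 : ¬ rowEquiv N (0, j) < rowEquiv N (1, k) := by rw [hlt]; simp; omega
    have e3 : ¬ rowEquiv N (1, j) < rowEquiv N (0, k) := by rw [hlt]; simp; omega
    have e4 : ¬ rowEquiv N (1, j) < rowEquiv N (1, k) := by rw [hlt]; simp; omega
    rw [if_neg e1, if_neg e2, if_neg e3, if_neg e4, if_neg h1, if_neg hjk.not_gt]
    simp

/-- The frequencies in increasing order: the negative ones run backwards, so `(0, c)` goes to
position `N - 1 - c`. -/
lemma exists_colEquiv (N : ℕ) : ∃ e : Fin 2 × Fin N ≃ Fin (N * 2),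
    ∀ x, freq x = ((e x : ℕ) : ℝ) - (((N * 2 : ℕ) : ℝ) - 1) / 2 := by
  let f : Fin 2 × Fin N → Fin (N * 2) := fun x =>
    if x.1 = 0 then ⟨N - 1 - x.2, by have := x.2.2; omega⟩ else ⟨N + x.2, by have := x.2.2; omega⟩
  have hf : Function.Injective f := by
    rintro ⟨a, i⟩ ⟨b, j⟩ hab
    have hi := i.2
    have hj := j.2
    have ha : a = 0 ∨ a = 1 := by omega
    have hb : b = 0 ∨ b = 1 := by omega
    rcases ha with rfl | rfl <;> rcases hb with rfl | rfl <;>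
      simp only [f, if_true, if_neg one_ne_zero, Fin.mk.injEq] at hab
    · exact Prod.ext rfl (Fin.ext (show (i : ℕ) = j by omega))
    · omega
    · omega
    · exact Prod.ext rfl (Fin.ext (show (i : ℕ) = j by omega))
  refine ⟨Equiv.ofBijective f ((Fintype.bijective_iff_injective_and_card f).2
    ⟨hf, by simp [mul_comm]⟩), ?_⟩
  rintro ⟨a, i⟩
  have hi := i.2
  fin_cases a
  · simp only [freq, ofBijective_apply, f, Fin.zero_eta, if_true]
    rw [Nat.cast_sub (by omega), Nat.cast_sub (by omega)]
    push_cast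
    ring
  · simp [freq, f]
    ring

/-- The determinant of the doubled Vandermonde matrix at the angles `θ_j` and `θ_j + h`. -/
lemma exists_det_doubled (N : ℕ) : ∃ κ : ℝ, κ ≠ 0 ∧ ∀ (θ : Fin N → ℝ) (h : ℝ),
    (Matrix.of fun (y x : Fin 2 × Fin N) => Complex.exp
      (Complex.I * ((freq x : ℂ) * ((θ y.2 + (y.1 : ℝ) * h : ℝ) : ℂ)))).det
    = κ * (chord h ^ N * ∏ j, ∏ k ∈ Finset.Ioi j, (chord (θ k - θ j) ^ 2
        * chord (θ k - θ j + h) * chord (θ k - θ j - h))) := by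
  obtain ⟨e, he⟩ := exists_colEquiv N
  -- `κ` is the sign of the passage from row order to column order. Its value is immaterial, since
  -- constant factors cancel in the two-point function.
  refine ⟨((Perm.sign ((rowEquiv N).symm.trans e) : ℤ) : ℝ), ?_, fun θ h => ?_⟩
  · rcases Int.units_eq_one_or (Perm.sign ((rowEquiv N).symm.trans e)) with h | h <;> simp [h]
  set φ : Fin (N * 2) → ℝ := fun i =>
    θ ((rowEquiv N).symm i).2 + (((rowEquiv N).symm i).1 : ℝ) * h with hφ
  rw [Complex.ofReal_intCast, ← prod_rowEquiv_pairs N chord θ h φ (fun x => by simp [hφ]), ← det_exp_centered,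
    ← Matrix.det_permute', ← Matrix.det_submatrix_equiv_self (rowEquiv N)]
  congr 1
  ext y x
  simp only [Matrix.submatrix_apply, Matrix.of_apply, he, hφ, symm_apply_apply, id, trans_apply]

lemma hasDerivAt_chord_zero : HasDerivAt chord Complex.I 0 := by
  have h1 : HasDerivAt (fun u : ℝ => u / 2) (1 / 2) 0 := (hasDerivAt_id (0 : ℝ)).div_const 2
  have h2 := (h1.sin.ofReal_comp).const_mul (2 * Complex.I)
  refine h2.congr_deriv ?_
  simp
  ring

lemma continuous_chord : Continuous chord := by
  unfold chord
  fun_prop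

/-- At `β = 4` the weight is a confluent Vandermonde determinant. -/
lemma exists_weight_four_eq_det (N : ℕ) : ∃ κ : ℝ, κ ≠ 0 ∧ ∀ θ : Fin N → ℝ,
    (weight 4 θ : ℂ) = κ * (confluent θ).det := by
  obtain ⟨κ, hκ, H⟩ := exists_det_doubled N
  refine ⟨κ⁻¹, inv_ne_zero hκ, fun θ => ?_⟩
  rw [Complex.ofReal_inv, eq_inv_mul_iff_mul_eq₀ (by exact_mod_cast hκ)]
  set V : ℝ → Matrix (Fin 2 × Fin N) (Fin 2 × Fin N) ℂ := fun h => Matrix.of fun y x =>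
    Complex.exp (Complex.I * ((freq x : ℂ) * ((θ y.2 + (y.1 : ℝ) * h : ℝ) : ℂ))) with hV
  -- Multiplication by `B h` replaces the row at `θ_j + h` by its difference quotient with the row
  -- at `θ_j`, divided by `i`. As `h → 0` the matrix tends to `confluent θ`, while the factor `(i
  -- h)⁻ᴺ` turns `chord h ^ N` into `1`.
  set B : ℝ → Matrix (Fin 2 × Fin N) (Fin 2 × Fin N) ℂ := fun h => Matrix.blockDiagonal fun _ =>
    !![1, 0; -(Complex.I * h)⁻¹, (Complex.I * h)⁻¹] with hB
  have hBdet : ∀ h, (B h).det = ((Complex.I * h)⁻¹) ^ N := by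
    intro h
    rw [hB, Matrix.det_blockDiagonal]
    simp [Matrix.det_fin_two]
  have hBV0 : ∀ h j x, (B h * V h) (0, j) x
      = Complex.exp (Complex.I * ((freq x : ℂ) * (θ j : ℂ))) := by
    intro h j x
    rw [Matrix.mul_apply, Fintype.sum_prod_type]
    simp [hB, hV, Matrix.blockDiagonal_apply]
  have hBV1 : ∀ h j x, (B h * V h) (1, j) x = (Complex.I * h)⁻¹ *
      (Complex.exp (Complex.I * ((freq x : ℂ) * ((θ j + h : ℝ) : ℂ)))
        - Complex.exp (Complex.I * ((freq x : ℂ) * (θ j : ℂ)))) := by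
    intro h j x
    rw [Matrix.mul_apply, Fintype.sum_prod_type]
    simp [hB, hV, Matrix.blockDiagonal_apply]
    ring
  have hlim1 : Tendsto (fun h => (B h * V h).det) (𝓝[≠] 0) (𝓝 (confluent θ).det) := by
    refine ((continuous_id.matrix_det).tendsto (confluent θ)).comp ?_
    refine tendsto_pi_nhds.2 fun y => tendsto_pi_nhds.2 fun x => ?_
    obtain ⟨a, j⟩ := y
    have ha : a = 0 ∨ a = 1 := by omega
    rcases ha with rfl | rfl
    · simp only [hBV0]
      simp [confluent]
    · simp only [hBV1]
      have h1 : HasDerivAt (fun h : ℝ => Complex.I * ((freq x : ℂ) * ((θ j + h : ℝ) : ℂ)))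
          (Complex.I * ((freq x : ℂ) * 1)) 0 := by
        have := ((hasDerivAt_id (0 : ℝ)).const_add (θ j)).ofReal_comp
        simpa using (this.const_mul (freq x : ℂ)).const_mul Complex.I
      have h2 := (h1.cexp).tendsto_slope_zero
      have h3 := h2.const_mul (Complex.I⁻¹)
      refine (h3.congr' ?_).trans (le_of_eq ?_)
      · refine Eventually.of_forall fun h => ?_
        simp only [zero_add, add_zero, Complex.real_smul, Complex.ofReal_inv]
        rw [mul_inv]
        ring
      · congr 1
        simp only [confluent, Matrix.of_apply, add_zero, mul_one, if_neg one_ne_zero]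
        field_simp
  have hlim2 : Tendsto (fun h => (B h * V h).det) (𝓝[≠] 0) (𝓝 (κ * (1 ^ N *
      ∏ j, ∏ k ∈ Finset.Ioi j, (chord (θ k - θ j) ^ 2
        * chord (θ k - θ j + 0) * chord (θ k - θ j - 0))))) := by
    have hs : Tendsto (fun h : ℝ => (Complex.I * h)⁻¹ * chord h) (𝓝[≠] 0) (𝓝 1) := by
      have h3 := (hasDerivAt_chord_zero.tendsto_slope_zero).const_mul (Complex.I⁻¹)
      rw [inv_mul_cancel₀ Complex.I_ne_zero] at h3
      refine h3.congr fun h => ?_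
      have hc0 : chord 0 = 0 := by simp [chord]
      simp only [zero_add, hc0, sub_zero, Complex.real_smul, Complex.ofReal_inv, mul_inv]
      ring
    have hp : Tendsto (fun h : ℝ => ∏ j, ∏ k ∈ Finset.Ioi j, (chord (θ k - θ j) ^ 2
        * chord (θ k - θ j + h) * chord (θ k - θ j - h))) (𝓝[≠] 0)
        (𝓝 (∏ j, ∏ k ∈ Finset.Ioi j, (chord (θ k - θ j) ^ 2
        * chord (θ k - θ j + 0) * chord (θ k - θ j - 0)))) := by
      have hc : Continuous fun h : ℝ => ∏ j, ∏ k ∈ Finset.Ioi j, (chord (θ k - θ j) ^ 2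
        * chord (θ k - θ j + h) * chord (θ k - θ j - h)) := by
        have := continuous_chord
        fun_prop
      exact (hc.tendsto 0).mono_left nhdsWithin_le_nhds
    refine (((hs.pow N).mul hp).const_mul (κ : ℂ)).congr fun h => ?_
    rw [Matrix.det_mul, hBdet, hV, H, mul_pow]
    ring
  have := tendsto_nhds_unique hlim1 hlim2
  rw [this]
  congr 1
  simp only [weight, one_pow, one_mul, add_zero, sub_zero]
  rw [Complex.ofReal_prod]
  refine Finset.prod_congr rfl fun j _ => ?_
  rw [Complex.ofReal_prod]
  refine Finset.prod_congr rfl fun k _ => ?_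
  rw [norm_exp_sub_exp_pow_four]
  ring

/-! ### Integrating out the confluent determinant -/

/-- The index of the opposite frequency. -/
def opp {N : ℕ} (x : Fin 2 × Fin N) : Fin 2 × Fin N := (swap 0 1 x.1, x.2)

lemma freq_zero {N : ℕ} (c : Fin N) : freq (0, c) = -((c : ℝ) + 1 / 2) := by simp [freq]

lemma freq_one {N : ℕ} (c : Fin N) : freq (1, c) = (c : ℝ) + 1 / 2 := by simp [freq]

lemma freq_add_freq {N : ℕ} (x y : Fin 2 × Fin N) :
    ∃ m : ℤ, freq x + freq y = m ∧ (m = 0 ↔ x = opp y) := by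
  obtain ⟨a, i⟩ := x
  obtain ⟨b, j⟩ := y
  have ha : a = 0 ∨ a = 1 := by omega
  have hb : b = 0 ∨ b = 1 := by omega
  rcases ha with rfl | rfl <;> rcases hb with rfl | rfl
  · refine ⟨-(i : ℤ) - j - 1, by rw [freq_zero, freq_zero]; push_cast; ring, ?_⟩
    simp [opp]
    omega
  · refine ⟨(j : ℤ) - i, by rw [freq_zero, freq_one]; push_cast; ring, ?_⟩
    simp [opp, Fin.ext_iff]
    omega
  · refine ⟨(i : ℤ) - j, by rw [freq_zero, freq_one]; push_cast; ring, ?_⟩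
    simp [opp, Fin.ext_iff]
    omega
  · refine ⟨(i : ℤ) + j + 1, by rw [freq_one, freq_one]; push_cast; ring, ?_⟩
    simp [opp]
    omega

/-- A row of the confluent Vandermonde matrix. -/
noncomputable def confluentRow {N : ℕ} (a : Fin 2) (s : ℝ) (x : Fin 2 × Fin N) : ℂ :=
  (if a = 0 then 1 else (freq x : ℂ)) * Complex.exp (Complex.I * ((freq x : ℂ) * (s : ℂ)))

/-- Two half-integer frequencies add to an integer, so only opposite ones survive. Writing the
result as a sum of products of unit vectors lets each term be read as two rows of a determinant. -/
lemma integral_confluentRow_mul {N : ℕ} (x y : Fin 2 × Fin N) :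
    ∫ s in Set.Ico 0 (2 * Real.pi), confluentRow 0 s x * confluentRow 1 s y
      = ∑ w : Fin 2 × Fin N, (2 * Real.pi * freq w : ℂ) *
        ((Pi.single (opp w) 1 : Fin 2 × Fin N → ℂ) x * (Pi.single w 1 : Fin 2 × Fin N → ℂ) y) := by
  obtain ⟨m, hm, hm0⟩ := freq_add_freq x y
  have : ∀ s : ℝ, confluentRow 0 s x * confluentRow 1 s y
      = (freq y : ℂ) * Complex.exp (Complex.I * (m * (s : ℂ))) := by
    intro s
    have hm' : (freq x : ℂ) + freq y = m := by exact_mod_cast hm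
    simp only [confluentRow, if_true, if_neg one_ne_zero, one_mul]
    rw [mul_left_comm, ← Complex.exp_add, ← hm']
    ring_nf
  simp_rw [this]
  rw [integral_const_mul, integral_exp_int_mul, Finset.sum_eq_single y]
  · by_cases h : x = opp y
    · rw [if_pos (hm0.2 h), h]
      simp
      ring
    · rw [if_neg (fun h' => h (hm0.1 h')), Pi.single_eq_of_ne h]
      simp
  · intro w _ hw
    rw [Pi.single_eq_of_ne hw.symm]
    simp
  · simp

/-- The confluent Vandermonde matrix with all rows but those of the first two angles replaced by
unit vectors. -/
noncomputable def reducedMatrix {n : ℕ} (s t : ℝ) (w : Fin n → Fin 2 × Fin (n + 2)) :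
    Matrix (Fin 2 × Fin (n + 2)) (Fin 2 × Fin (n + 2)) ℂ :=
  Matrix.of fun y => (Matrix.vecCons (confluentRow y.1 s) (Matrix.vecCons (confluentRow y.1 t)
    fun j => Pi.single (if y.1 = 0 then opp (w j) else w j) 1) :
      Fin (n + 2) → Fin 2 × Fin (n + 2) → ℂ) y.2

/-- Each integrated angle occupies exactly two rows, so every term of the Leibniz expansion factors
over the angles. Replacing each factor by its sum over `w j` and resumming over permutations gives
determinants again. -/
lemma integral_det_confluent (n : ℕ) (s t : ℝ) :
    ∫ φ in angles n, (confluent (Matrix.vecCons s (Matrix.vecCons t φ))).det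
      = ∑ w : Fin n → Fin 2 × Fin (n + 2), (∏ j, (2 * Real.pi * freq (w j) : ℂ)) *
        (reducedMatrix s t w).det := by
  have hexp : ∀ M : Matrix (Fin 2 × Fin (n + 2)) (Fin 2 × Fin (n + 2)) ℂ,
      M.det = ∑ σ : Perm (Fin 2 × Fin (n + 2)), ((Perm.sign σ : ℤ) : ℂ) *
        ((M (0, 0) (σ (0, 0)) * M (1, 0) (σ (1, 0))) * ((M (0, 1) (σ (0, 1)) * M (1, 1) (σ (1, 1))) *
          ∏ j : Fin n, (M (0, j.succ.succ) (σ (0, j.succ.succ)) *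
            M (1, j.succ.succ) (σ (1, j.succ.succ))))) := by
    intro M
    rw [← Matrix.det_transpose, Matrix.det_apply']
    refine Finset.sum_congr rfl fun σ _ => ?_
    rw [Fintype.prod_prod_type_right]
    simp only [Fin.prod_univ_two, Fin.prod_univ_succ (n := n + 1), Fin.prod_univ_succ (n := n),
      Matrix.transpose_apply, Fin.succ_zero_eq_one]
  simp_rw [hexp]
  rw [integral_finsetSum]
  swap
  · intro σ _
    refine integrableOn_angles ?_
    simp only [confluent, Matrix.of_apply]
    fun_prop
  simp_rw [Finset.mul_sum]
  rw [Finset.sum_comm]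
  refine Finset.sum_congr rfl fun σ _ => ?_
  have h0 : ∀ (φ : Fin n → ℝ) (a : Fin 2) x,
      confluent (Matrix.vecCons s (Matrix.vecCons t φ)) (a, 0) x = confluentRow a s x :=
    fun _ _ _ => rfl
  have h1 : ∀ (φ : Fin n → ℝ) (a : Fin 2) x,
      confluent (Matrix.vecCons s (Matrix.vecCons t φ)) (a, 1) x = confluentRow a t x :=
    fun _ _ _ => rfl
  have h2 : ∀ (φ : Fin n → ℝ) (a : Fin 2) (j : Fin n) x,
      confluent (Matrix.vecCons s (Matrix.vecCons t φ)) (a, j.succ.succ) x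
        = confluentRow a (φ j) x :=
    fun _ _ _ _ => rfl
  have g0 : ∀ (w : Fin n → Fin 2 × Fin (n + 2)) (a : Fin 2) x,
      reducedMatrix s t w (a, 0) x = confluentRow a s x := fun _ _ _ => rfl
  have g1 : ∀ (w : Fin n → Fin 2 × Fin (n + 2)) (a : Fin 2) x,
      reducedMatrix s t w (a, 1) x = confluentRow a t x := fun _ _ _ => rfl
  have g2 : ∀ (w : Fin n → Fin 2 × Fin (n + 2)) (j : Fin n) x,
      reducedMatrix s t w (0, j.succ.succ) x
        = (Pi.single (opp (w j)) 1 : Fin 2 × Fin (n + 2) → ℂ) x := fun _ _ _ => rfl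
  have g3 : ∀ (w : Fin n → Fin 2 × Fin (n + 2)) (j : Fin n) x,
      reducedMatrix s t w (1, j.succ.succ) x
        = (Pi.single (w j) 1 : Fin 2 × Fin (n + 2) → ℂ) x := fun _ _ _ => rfl
  simp_rw [h0, h1, h2, g0, g1, g2, g3]
  rw [integral_const_mul, integral_const_mul, integral_const_mul]
  rw [integral_angles_prod fun (j : Fin n) (x : ℝ) => confluentRow 0 x (σ (0, j.succ.succ)) *
    confluentRow 1 x (σ (1, j.succ.succ))]
  simp_rw [integral_confluentRow_mul]
  rw [Finset.prod_univ_sum, Fintype.piFinset_univ, Finset.mul_sum, Finset.mul_sum, Finset.mul_sum]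
  refine Finset.sum_congr rfl fun w _ => ?_
  rw [Finset.prod_mul_distrib]
  ring

/-- The unit rows attached to `j` sit at `w j` and its opposite; if two angles share such a pair,
two rows coincide. -/
lemma det_reducedMatrix_of_not_injective {n : ℕ} (s t : ℝ) (w : Fin n → Fin 2 × Fin (n + 2))
    (hw : ¬ Function.Injective fun j => (w j).2) : (reducedMatrix s t w).det = 0 := by
  simp only [Function.Injective, not_forall] at hw
  obtain ⟨i, j, hij, hne⟩ := hw
  have hne' : i.succ.succ ≠ j.succ.succ := fun h => hne (succ_succ_injective h)
  have h2 : (w i).1 = (w j).1 ∨ (w i).1 = swap 0 1 (w j).1 := by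
    generalize (w i).1 = a
    generalize (w j).1 = b
    revert a b
    decide
  rcases h2 with h | h
  · have hwij : w i = w j := Prod.ext h hij
    refine Matrix.det_zero_of_row_eq (i := (1, i.succ.succ)) (j := (1, j.succ.succ))
      (fun h => hne' (Prod.ext_iff.1 h).2) ?_
    change (Pi.single (w i) 1 : Fin 2 × Fin (n + 2) → ℂ) = Pi.single (w j) 1
    rw [hwij]
  · have hwij : w i = opp (w j) := Prod.ext h hij
    refine Matrix.det_zero_of_row_eq (i := (1, i.succ.succ)) (j := (0, j.succ.succ))
      (fun h => hne' (Prod.ext_iff.1 h).2) ?_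
    change (Pi.single (w i) 1 : Fin 2 × Fin (n + 2) → ℂ) = Pi.single (opp (w j)) 1
    rw [hwij]

/-- The permutation of `Fin 2` taking `1` to `a`. -/
def flipTo (a : Fin 2) : Perm (Fin 2) := if a = 0 then swap 0 1 else 1

lemma flipTo_one (a : Fin 2) : flipTo a 1 = a := by revert a; decide

lemma flipTo_zero (a : Fin 2) : flipTo a 0 = swap 0 1 a := by revert a; decide

/-- The sign of the frequency is offset by that of the column flip, so all `2 ^ n` choices of signs
`ε` contribute equally. -/
lemma freq_mul_sign_flipTo {N : ℕ} (a : Fin 2) (c : Fin N) :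
    freq (a, c) * ((Perm.sign (flipTo a) : ℤ) : ℝ) = freq (1, c) := by
  have ha : a = 0 ∨ a = 1 := by omega
  rcases ha with rfl | rfl
  · simp [flipTo, freq_zero, freq_one, Perm.sign_swap (zero_ne_one (α := Fin 2))]
  · simp [flipTo]

/-- The permutation of the columns that brings `reducedMatrix` into block triangular form. -/
def columnPerm {n : ℕ} (π : Perm (Fin (n + 2))) (ε : Fin n → Fin 2) :
    Perm (Fin 2 × Fin (n + 2)) :=
  (Equiv.prodCongrLeft (Matrix.vecCons 1 (Matrix.vecCons 1 fun j => flipTo (ε j)) :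
    Fin (n + 2) → Perm (Fin 2))).trans (Equiv.prodCongrRight fun _ => π)

/-- `π` acts on two copies of the columns, so its sign is squared and only the flips count. -/
lemma sign_columnPerm {n : ℕ} (π : Perm (Fin (n + 2))) (ε : Fin n → Fin 2) :
    Perm.sign (columnPerm π ε) = ∏ j, Perm.sign (flipTo (ε j)) := by
  have h1 := Perm.sign_prodCongrRight (fun _ : Fin 2 => π)
  have h2 := Perm.sign_prodCongrLeft (Matrix.vecCons 1 (Matrix.vecCons 1 fun j => flipTo (ε j)) :
    Fin (n + 2) → Perm (Fin 2))
  rw [columnPerm, Perm.sign_trans, h1, h2]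
  simp [Fin.prod_univ_succ]

/-- After `columnPerm` every unit row has its `1` on the diagonal. The matrix is then block
triangular with an identity block, leaving the four rows of the first two angles on the columns `π
0` and `π 1`. -/
lemma det_reducedMatrix {n : ℕ} (s t : ℝ) (π : Perm (Fin (n + 2))) (ε : Fin n → Fin 2) :
    (reducedMatrix s t fun j => (ε j, π j.succ.succ)).det
      = (∏ j, ((Perm.sign (flipTo (ε j)) : ℤ) : ℂ)) *
        (!![confluentRow 0 s (0, π 0), confluentRow 0 s (1, π 0),
              confluentRow 0 s (0, π 1), confluentRow 0 s (1, π 1);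
            confluentRow 1 s (0, π 0), confluentRow 1 s (1, π 0),
              confluentRow 1 s (0, π 1), confluentRow 1 s (1, π 1);
            confluentRow 0 t (0, π 0), confluentRow 0 t (1, π 0),
              confluentRow 0 t (0, π 1), confluentRow 0 t (1, π 1);
            confluentRow 1 t (0, π 0), confluentRow 1 t (1, π 0),
              confluentRow 1 t (0, π 1), confluentRow 1 t (1, π 1)]).det := by
  set R := reducedMatrix s t fun j => (ε j, π j.succ.succ) with hR
  set τ := columnPerm π ε with hτ
  have hsq : ((Perm.sign τ : ℤ) : ℂ) * ((Perm.sign τ : ℤ) : ℂ) = 1 := by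
    rw [← Int.cast_mul, ← Units.val_mul, Int.units_mul_self]
    simp
  have hperm : R.det = ((Perm.sign τ : ℤ) : ℂ) * (R.submatrix id τ).det := by
    rw [Matrix.det_permute', ← mul_assoc, hsq, one_mul]
  have hτ0 : ∀ a, τ (a, 0) = (a, π 0) := fun _ => rfl
  have hτ1 : ∀ a, τ (a, 1) = (a, π 1) := fun _ => rfl
  have hτ2 : ∀ a j, τ (a, Fin.succ (Fin.succ j)) = (flipTo (ε j) a, π j.succ.succ) := fun _ _ => rfl
  have hrow : ∀ a (j : Fin n) x, (R.submatrix id τ) (a, j.succ.succ) x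
      = if x = (a, j.succ.succ) then 1 else 0 := by
    intro a j x
    have : R (a, j.succ.succ) = Pi.single (τ (a, j.succ.succ)) 1 := by
      have ha : a = 0 ∨ a = 1 := by omega
      rcases ha with rfl | rfl
      · rw [hτ2, flipTo_zero]
        rfl
      · rw [hτ2, flipTo_one]
        rfl
    rw [Matrix.submatrix_apply, id, this, Pi.single_apply]
    simp only [EmbeddingLike.apply_eq_iff_eq]
  let p : Fin 2 × Fin (n + 2) → Prop := fun x => x.2 = 0 ∨ x.2 = 1
  have hnp : ∀ x, ¬ p x → ∃ a, ∃ j : Fin n, x = (a, j.succ.succ) := by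
    rintro ⟨a, i⟩
    refine Fin.cases (fun h => absurd (Or.inl rfl) h) (fun i => ?_) i
    refine Fin.cases (fun h => absurd (Or.inr rfl) h) (fun j _ => ⟨a, j, rfl⟩) i
  rw [hperm, hτ, sign_columnPerm, ← hτ, Units.coe_prod, Int.cast_prod,
    Matrix.twoBlockTriangular_det _ p]
  · congr 1
    have hone : Matrix.toSquareBlockProp (R.submatrix id τ) (fun x => ¬ p x) = 1 := by
      ext ⟨x, hx⟩ ⟨y, hy⟩
      obtain ⟨a, j, rfl⟩ := hnp x hx
      rw [Matrix.toSquareBlockProp_def, Matrix.of_apply, hrow, Matrix.one_apply]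
      simp only [Subtype.mk.injEq, eq_comm]
    rw [hone, Matrix.det_one, mul_one]
    let f : Fin 4 → {x // p x} :=
      ![⟨(0, 0), Or.inl rfl⟩, ⟨(1, 0), Or.inl rfl⟩, ⟨(0, 1), Or.inr rfl⟩, ⟨(1, 1), Or.inr rfl⟩]
    have hf : Function.Bijective f := by
      constructor
      · intro i j
        fin_cases i <;> fin_cases j <;> simp [f]
      · rintro ⟨⟨a, i⟩, h⟩
        have ha : a = 0 ∨ a = 1 := by omega
        rcases h with h | h <;> rcases ha with rfl | rfl <;> simp only at h <;> subst h
        · exact ⟨0, rfl⟩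
        · exact ⟨1, rfl⟩
        · exact ⟨2, rfl⟩
        · exact ⟨3, rfl⟩
    rw [← Matrix.det_submatrix_equiv_self (Equiv.ofBijective f hf)]
    congr 1
    ext i j
    fin_cases i <;> fin_cases j <;> rfl
  · intro x hx y hy
    obtain ⟨a, j, rfl⟩ := hnp x hx
    rw [hrow, if_neg]
    rintro rfl
    exact hx hy

lemma det_confluent_four {N : ℕ} (s t : ℝ) (a b : Fin N) :
    (!![confluentRow 0 s (0, a), confluentRow 0 s (1, a),
          confluentRow 0 s (0, b), confluentRow 0 s (1, b);
        confluentRow 1 s (0, a), confluentRow 1 s (1, a),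
          confluentRow 1 s (0, b), confluentRow 1 s (1, b);
        confluentRow 0 t (0, a), confluentRow 0 t (1, a),
          confluentRow 0 t (0, b), confluentRow 0 t (1, b);
        confluentRow 1 t (0, a), confluentRow 1 t (1, a),
          confluentRow 1 t (0, b), confluentRow 1 t (1, b)]).det
      = ((8 * freq (1, a) * freq (1, b)
        + 2 * (freq (1, a) - freq (1, b)) ^ 2 * Real.cos ((freq (1, a) + freq (1, b)) * (s - t))
        - 2 * (freq (1, a) + freq (1, b)) ^ 2 * Real.cos ((freq (1, a) - freq (1, b)) * (s - t))
          : ℝ) : ℂ) := by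
  have hneg : ∀ c : Fin N, freq (0, c) = -freq (1, c) := fun c => by rw [freq_zero, freq_one]
  simp only [confluentRow, hneg, if_true, if_neg one_ne_zero, one_mul]
  generalize freq (1, a) = α
  generalize freq (1, b) = β
  have e1 : ∀ x y : ℝ, Complex.exp (Complex.I * (((-x : ℝ) : ℂ) * (y : ℂ)))
      = (Complex.exp (Complex.I * ((x : ℂ) * (y : ℂ))))⁻¹ := by
    intro x y
    rw [← Complex.exp_neg]
    push_cast
    ring_nf
  have e2 : ∀ x : ℝ, (2 * Real.cos (x * (s - t)) : ℂ) = Complex.exp (Complex.I * (x * s)) *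
      (Complex.exp (Complex.I * (x * t)))⁻¹ + (Complex.exp (Complex.I * (x * s)))⁻¹ *
      Complex.exp (Complex.I * (x * t)) := by
    intro x
    rw [Complex.ofReal_cos, Complex.two_cos, ← Complex.exp_neg, ← Complex.exp_neg,
      ← Complex.exp_add, ← Complex.exp_add]
    push_cast
    ring_nf
  have e3 := e2 (α + β)
  have e4 := e2 (α - β)
  have e5 : ∀ y : ℝ, Complex.exp (Complex.I * (((α + β : ℝ) : ℂ) * y))
      = Complex.exp (Complex.I * (α * y)) * Complex.exp (Complex.I * (β * y)) := by
    intro y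
    rw [← Complex.exp_add]
    push_cast
    ring_nf
  have e6 : ∀ y : ℝ, Complex.exp (Complex.I * (((α - β : ℝ) : ℂ) * y))
      = Complex.exp (Complex.I * (α * y)) * (Complex.exp (Complex.I * (β * y)))⁻¹ := by
    intro y
    rw [← Complex.exp_neg, ← Complex.exp_add]
    push_cast
    ring_nf
  rw [e5, e5] at e3
  rw [e6, e6] at e4
  -- All entries are now Laurent monomials in four exponentials, times frequencies; after these are
  -- generalised the claim is an identity of rational functions.
  simp only [e1]
  have hA := Complex.exp_ne_zero (Complex.I * (α * s))
  have hB := Complex.exp_ne_zero (Complex.I * (β * s))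
  have hC := Complex.exp_ne_zero (Complex.I * (α * t))
  have hD := Complex.exp_ne_zero (Complex.I * (β * t))
  generalize Complex.exp (Complex.I * (α * s)) = A at *
  generalize Complex.exp (Complex.I * (β * s)) = B at *
  generalize Complex.exp (Complex.I * (α * t)) = C at *
  generalize Complex.exp (Complex.I * (β * t)) = D at *
  push_cast at e3 e4 ⊢
  rw [show (2 : ℂ) * (α - β) ^ 2 * Complex.cos ((α + β) * (s - t))
      = (α - β) ^ 2 * (2 * Complex.cos ((α + β) * (s - t))) by ring,
    show (2 : ℂ) * (α + β) ^ 2 * Complex.cos ((α - β) * (s - t))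
      = (α + β) ^ 2 * (2 * Complex.cos ((α - β) * (s - t))) by ring, e3, e4]
  simp [Matrix.det_succ_row_zero, Fin.sum_univ_succ, Fin.succAbove]
  field_simp
  ring

/-- The contribution of a pair of frequencies to the two-point function at `β = 4`. -/
noncomputable def pairKernel {N : ℕ} (x : Fin N × Fin N) (u : ℝ) : ℝ :=
  1 + (freq (1, x.1) - freq (1, x.2)) ^ 2 / (4 * freq (1, x.1) * freq (1, x.2)) *
      Real.cos ((freq (1, x.1) + freq (1, x.2)) * u)
    + -((freq (1, x.1) + freq (1, x.2)) ^ 2 / (4 * freq (1, x.1) * freq (1, x.2))) *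
      Real.cos ((freq (1, x.1) - freq (1, x.2)) * u)

lemma freq_one_pos {N : ℕ} (c : Fin N) : 0 < freq (1, c) := by
  rw [freq_one]
  positivity

/-- Split `w` into signs `ε` and columns `c`. Non-injective `c` give zero, and each injective `c` is
the restriction of two permutations, so the sum over `c` is half a sum over permutations of a
function of `π 0` and `π 1`. -/
lemma integral_weight_four (n : ℕ) : ∃ C : ℝ, C ≠ 0 ∧ ∀ s t : ℝ,
    ∫ φ in angles n, weight 4 (Matrix.vecCons s (Matrix.vecCons t φ))
      = C * ∑ x ∈ (Finset.univ : Finset (Fin (n + 2))).offDiag, pairKernel x (s - t) := by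
  obtain ⟨κ, hκ, hdet⟩ := exists_weight_four_eq_det (n + 2)
  obtain ⟨m, hm, hsum⟩ := exists_sum_perm_zero_one n
  set P : ℝ := ∏ i : Fin (n + 2), freq (1, i) with hP
  have hP0 : P ≠ 0 := (Finset.prod_pos fun i _ => freq_one_pos i).ne'
  -- The factors come from the determinant formula (`κ`), the signs `ε` (`2 ^ n`), the two
  -- extensions of `c` (`1 / 2`), the common value of the terms (`(2π) ^ n * P * 8`) and the fibre
  -- size `m`.
  refine ⟨κ * (2 ^ n * (1 / 2 * ((2 * Real.pi) ^ n * P * 8 * m))), by positivity, fun s t => ?_⟩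
  set H : Fin (n + 2) × Fin (n + 2) → ℂ := fun x => ((2 * Real.pi) ^ n * P * 8 : ℂ) *
    (pairKernel x (s - t) : ℂ) with hH
  have hterm : ∀ (ε : Fin n → Fin 2) (π : Perm (Fin (n + 2))),
      (∏ j, (2 * Real.pi * freq (ε j, π j.succ.succ) : ℂ)) *
        (reducedMatrix s t fun j => (ε j, π j.succ.succ)).det
      = H (π 0, π 1) := by
    intro ε π
    simp only [hH]
    rw [det_reducedMatrix, det_confluent_four, ← mul_assoc, ← Finset.prod_mul_distrib]
    have h1 : ∀ j, (2 * Real.pi * freq (ε j, π j.succ.succ) : ℂ) *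
        ((Perm.sign (flipTo (ε j)) : ℤ) : ℂ) = ((2 * Real.pi * freq (1, π j.succ.succ) : ℝ) : ℂ) := by
      intro j
      rw [← freq_mul_sign_flipTo (ε j)]
      push_cast
      ring
    -- The factor `8 * freq * freq` of the four-row determinant supplies the two frequencies missing
    -- from the product over the integrated angles, so the prefactor is independent of `π`.
    have h2 : P = freq (1, π 0) * (freq (1, π 1) * ∏ j : Fin n, freq (1, π j.succ.succ)) := by
      rw [hP, ← Equiv.prod_comp π, Fin.prod_univ_succ, Fin.prod_univ_succ, Fin.succ_zero_eq_one]
    have hk : 8 * freq (1, π 0) * freq (1, π 1)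
        + 2 * (freq (1, π 0) - freq (1, π 1)) ^ 2 *
          Real.cos ((freq (1, π 0) + freq (1, π 1)) * (s - t))
        - 2 * (freq (1, π 0) + freq (1, π 1)) ^ 2 *
          Real.cos ((freq (1, π 0) - freq (1, π 1)) * (s - t))
        = 8 * freq (1, π 0) * freq (1, π 1) * pairKernel (π 0, π 1) (s - t) := by
      have ha := (freq_one_pos (π 0)).ne'
      have hb := (freq_one_pos (π 1)).ne'
      simp only [pairKernel]
      generalize Real.cos ((freq (1, π 0) + freq (1, π 1)) * (s - t)) = c
      generalize Real.cos ((freq (1, π 0) - freq (1, π 1)) * (s - t)) = d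
      field_simp
      ring
    rw [Finset.prod_congr rfl fun j _ => h1 j, ← Complex.ofReal_prod, hk, Finset.prod_mul_distrib,
      Finset.prod_const, Finset.card_univ, Fintype.card_fin, h2]
    push_cast
    ring
  have hint : ((∫ φ in angles n, weight 4 (Matrix.vecCons s (Matrix.vecCons t φ)) : ℝ) : ℂ)
      = κ * ∑ ε : Fin n → Fin 2, ∑ c : Fin n → Fin (n + 2),
        (∏ j, (2 * Real.pi * freq (ε j, c j) : ℂ)) * (reducedMatrix s t fun j => (ε j, c j)).det := by
    rw [← integral_complex_ofReal]
    simp_rw [hdet]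
    rw [integral_const_mul, integral_det_confluent,
      ← (Equiv.arrowProdEquivProdArrow (Fin n) (fun _ => Fin 2) (fun _ => Fin (n + 2))).symm.sum_comp,
      Fintype.sum_prod_type]
    rfl
  have hε : ∀ ε : Fin n → Fin 2, ∑ c : Fin n → Fin (n + 2),
        (∏ j, (2 * Real.pi * freq (ε j, c j) : ℂ)) * (reducedMatrix s t fun j => (ε j, c j)).det
      = 1 / 2 * (m * ∑ x ∈ (Finset.univ : Finset (Fin (n + 2))).offDiag,
        ((2 * Real.pi) ^ n * P * 8 : ℂ) * (pairKernel x (s - t) : ℂ)) := by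
    intro ε
    have h := sum_perm_restrict (fun c : Fin n → Fin (n + 2) =>
      (∏ j, (2 * Real.pi * freq (ε j, c j) : ℂ)) * (reducedMatrix s t fun j => (ε j, c j)).det)
      fun c hc => by rw [det_reducedMatrix_of_not_injective s t _ hc, mul_zero]
    have h' := (Finset.sum_congr rfl fun π _ => hterm ε π).symm.trans h
    rw [hsum H] at h'
    simp only [hH] at h'
    rw [h']
    ring
  simp_rw [hε] at hint
  rw [Finset.sum_const, Finset.card_univ, Fintype.card_fun, Fintype.card_fin, Fintype.card_fin,
    nsmul_eq_mul, ← Finset.mul_sum, ← Complex.ofReal_sum] at hint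
  have : ((∫ φ in angles n, weight 4 (Matrix.vecCons s (Matrix.vecCons t φ)) : ℝ) : ℂ)
      = ((κ * (2 ^ n * (1 / 2 * ((2 * Real.pi) ^ n * P * 8 * m))) *
        ∑ x ∈ (Finset.univ : Finset (Fin (n + 2))).offDiag, pairKernel x (s - t) : ℝ) : ℂ) := by
    rw [hint]
    push_cast
    ring
  exact_mod_cast this

/-! ### Two-point functions at finite `N` -/

lemma twoPoint_two (n : ℕ) (s t : ℝ) : twoPoint 2 (n + 2) s t
    = (∑ x : Fin (n + 2) × Fin (n + 2), (1 - Real.cos (((x.1 : ℝ) - x.2) * (s - t))))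
      / (2 * Real.pi) ^ 2 := by
  obtain ⟨C, hC, hG⟩ := integral_weight_two n
  have h := twoPoint_eq_of_partial_integral (by norm_num : (0 : ℝ) ≤ 2) n hC (fun _ => -1)
    (fun _ => 0) (fun x => (((x.1 : ℕ) : ℤ) - ((x.2 : ℕ) : ℤ) : ℤ)) (fun _ => 1)
    (fun x hx => by rwa [sub_ne_zero, Ne, Nat.cast_inj, Fin.val_inj]) (fun _ _ => one_ne_zero)
    (fun s t => by
      rw [hG]
      congr 1
      refine Finset.sum_congr rfl fun x _ => ?_
      ring) s t
  rw [h]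
  congr 1
  rw [← Finset.univ_product_univ, ← Finset.diag_union_offDiag,
    Finset.sum_union (Finset.disjoint_diag_offDiag _), Finset.sum_diag]
  simp only [sub_self, zero_mul, Real.cos_zero, Finset.sum_const_zero, zero_add]
  refine Finset.sum_congr rfl fun x _ => ?_
  push_cast
  ring

/-- Allows the sum over distinct pairs to be extended to all pairs, so that it factors. -/
lemma pairKernel_diag {N : ℕ} (a : Fin N) (u : ℝ) : pairKernel (a, a) u = 0 := by
  have ha := (freq_one_pos a).ne'
  simp only [pairKernel, sub_self, zero_mul, Real.cos_zero]
  field_simp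
  ring

lemma twoPoint_four (n : ℕ) (s t : ℝ) : twoPoint 4 (n + 2) s t
    = (∑ x : Fin (n + 2) × Fin (n + 2), pairKernel x (s - t)) / (2 * Real.pi) ^ 2 := by
  obtain ⟨C, hC, hG⟩ := integral_weight_four n
  have hpair : ∀ (x : Fin (n + 2) × Fin (n + 2)) (u : ℝ), pairKernel x u =
      1 + (freq (1, x.1) - freq (1, x.2)) ^ 2 / (4 * freq (1, x.1) * freq (1, x.2)) *
      Real.cos (((((x.1 : ℕ) : ℤ) + ((x.2 : ℕ) : ℤ) + 1 : ℤ) : ℝ) * u)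
    + -((freq (1, x.1) + freq (1, x.2)) ^ 2 / (4 * freq (1, x.1) * freq (1, x.2))) *
      Real.cos (((((x.1 : ℕ) : ℤ) - ((x.2 : ℕ) : ℤ) : ℤ) : ℝ) * u) := by
    intro x u
    rw [pairKernel, show freq (1, x.1) + freq (1, x.2)
      = ((((x.1 : ℕ) : ℤ) + ((x.2 : ℕ) : ℤ) + 1 : ℤ) : ℝ) by
        rw [freq_one, freq_one]; push_cast; ring, show freq (1, x.1) - freq (1, x.2)
      = ((((x.1 : ℕ) : ℤ) - ((x.2 : ℕ) : ℤ) : ℤ) : ℝ) by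
        rw [freq_one, freq_one]; push_cast; ring]
  have h := twoPoint_eq_of_partial_integral (by norm_num : (0 : ℝ) ≤ 4) n hC
    (fun x => (freq (1, x.1) - freq (1, x.2)) ^ 2 / (4 * freq (1, x.1) * freq (1, x.2)))
    (fun x => -((freq (1, x.1) + freq (1, x.2)) ^ 2 / (4 * freq (1, x.1) * freq (1, x.2))))
    (fun x => (((x.1 : ℕ) : ℤ) + ((x.2 : ℕ) : ℤ) + 1 : ℤ))
    (fun x => (((x.1 : ℕ) : ℤ) - ((x.2 : ℕ) : ℤ) : ℤ))
    (fun x _ => by positivity)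
    (fun x hx => by rwa [sub_ne_zero, Ne, Nat.cast_inj, Fin.val_inj])
    (fun s t => by
      rw [hG]
      simp_rw [hpair]) s t
  rw [h]
  congr 1
  rw [← Finset.univ_product_univ, ← Finset.diag_union_offDiag,
    Finset.sum_union (Finset.disjoint_diag_offDiag _), Finset.sum_diag]
  simp_rw [pairKernel_diag]
  rw [Finset.sum_const_zero, zero_add]
  exact Finset.sum_congr rfl fun x _ => (hpair x _).symm

/-! ### The bulk scaling limit -/

/-- Midpoint sums over `Fin N`. -/
noncomputable def midpointSum (N : ℕ) (g : ℝ → ℝ) : ℝ :=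
  (∑ j : Fin N, g (((j : ℝ) + 1 / 2) / N)) / N

lemma tendsto_midpointSum {g : ℝ → ℝ} (hg : Continuous g) :
    Tendsto (fun N => midpointSum N g) atTop (𝓝 (∫ t in (0 : ℝ)..1, g t)) := by
  refine (tendsto_midpoint_sum hg).congr fun N => ?_
  rw [midpointSum, Fin.sum_univ_eq_sum_range fun j : ℕ => g (((j : ℝ) + 1 / 2) / N)]

/-- The cosine of a difference splits the double sum into squares of single sums. The shift by `1 /
2` cancels in the difference, so midpoints may be used. -/
lemma scaledTwoPoint_two (N : ℕ) (hN : 2 ≤ N) (X : ℝ) : scaledTwoPoint 2 N X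
    = 1 - midpointSum N (fun t => Real.cos (2 * Real.pi * X * t)) ^ 2
      - midpointSum N (fun t => Real.sin (2 * Real.pi * X * t)) ^ 2 := by
  obtain ⟨n, rfl⟩ : ∃ n, N = n + 2 := ⟨N - 2, by omega⟩
  have hpos : ((n + 2 : ℕ) : ℝ) ≠ 0 := by positivity
  rw [scaledTwoPoint, twoPoint_two, Fintype.sum_prod_type, sub_zero]
  set M : ℝ := ((n + 2 : ℕ) : ℝ) with hM
  have hterm : ∀ a b : Fin (n + 2), 1 - Real.cos (((a : ℝ) - b) * (2 * Real.pi * X / M))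
      = 1 - Real.cos (2 * Real.pi * X * (((a : ℝ) + 1 / 2) / M))
          * Real.cos (2 * Real.pi * X * (((b : ℝ) + 1 / 2) / M))
        - Real.sin (2 * Real.pi * X * (((a : ℝ) + 1 / 2) / M))
          * Real.sin (2 * Real.pi * X * (((b : ℝ) + 1 / 2) / M)) := by
    intro a b
    rw [sub_sub, ← Real.cos_sub]
    congr 2
    field_simp
    ring
  simp_rw [hterm, Finset.sum_sub_distrib, ← Finset.mul_sum, ← Finset.sum_mul]
  simp only [midpointSum, ← hM, Finset.sum_const, Finset.card_univ, Fintype.card_fin,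
    nsmul_eq_mul, mul_one]
  have hpi := Real.pi_ne_zero
  field_simp

lemma mul_sinc_mul (x t : ℝ) (ht : t ≠ 0) : x * Real.sinc (x * t) = Real.sin (x * t) / t := by
  rw [← sincDeriv_zero, eq_div_iff ht, mul_right_comm, mul_sincDeriv_zero]

/-- With `p`, `q` the rescaled frequencies and `x = 2πX`, the kernel is `1 - cos (x p) cos (x q) -
(p/q + q/p)/2 · sin (x p) sin (x q)`. The quotient `sin (x q) / q` is `x sinc (x q)`, which is
continuous at `0`, and the two halves have equal sums by symmetry. -/
lemma scaledTwoPoint_four (N : ℕ) (hN : 2 ≤ N) (X : ℝ) : scaledTwoPoint 4 N X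
    = 1 - midpointSum N (fun t => Real.cos (2 * Real.pi * X * t)) ^ 2
      - midpointSum N (fun t => t * Real.sin (2 * Real.pi * X * t))
        * midpointSum N (fun t => 2 * Real.pi * X * Real.sinc (2 * Real.pi * X * t)) := by
  obtain ⟨n, rfl⟩ : ∃ n, N = n + 2 := ⟨N - 2, by omega⟩
  have hpos : ((n + 2 : ℕ) : ℝ) ≠ 0 := by positivity
  rw [scaledTwoPoint, twoPoint_four, Fintype.sum_prod_type, sub_zero]
  set M : ℝ := ((n + 2 : ℕ) : ℝ) with hM
  set τ : Fin (n + 2) → ℝ := fun a => ((a : ℝ) + 1 / 2) / M with hτ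
  have hτ0 : ∀ a, τ a ≠ 0 := fun a => by
    have : (a : ℝ) + 1 / 2 ≠ 0 := by positivity
    exact div_ne_zero this hpos
  have hf : ∀ a : Fin (n + 2), freq (1, a) = τ a * M := fun a => by
    rw [freq_one, hτ]
    field_simp
  have hterm : ∀ a b : Fin (n + 2), pairKernel (a, b) (2 * Real.pi * X / M)
      = 1 - Real.cos (2 * Real.pi * X * τ a) * Real.cos (2 * Real.pi * X * τ b)
        - 1 / 2 * ((τ a * Real.sin (2 * Real.pi * X * τ a))
          * (2 * Real.pi * X * Real.sinc (2 * Real.pi * X * τ b)))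
        - 1 / 2 * ((2 * Real.pi * X * Real.sinc (2 * Real.pi * X * τ a))
          * (τ b * Real.sin (2 * Real.pi * X * τ b))) := by
    intro a b
    have ha := hτ0 a
    have hb := hτ0 b
    rw [mul_sinc_mul _ _ ha, mul_sinc_mul _ _ hb]
    simp only [pairKernel, hf]
    rw [show (τ a * M + τ b * M) * (2 * Real.pi * X / M)
        = 2 * Real.pi * X * τ a + 2 * Real.pi * X * τ b by field_simp,
      show (τ a * M - τ b * M) * (2 * Real.pi * X / M)
        = 2 * Real.pi * X * τ a - 2 * Real.pi * X * τ b by field_simp, Real.cos_add, Real.cos_sub]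
    generalize Real.cos (2 * Real.pi * X * τ a) = ca
    generalize Real.cos (2 * Real.pi * X * τ b) = cb
    generalize Real.sin (2 * Real.pi * X * τ a) = sa
    generalize Real.sin (2 * Real.pi * X * τ b) = sb
    generalize τ a = p at *
    generalize τ b = q at *
    field_simp
    ring
  simp_rw [hterm, Finset.sum_sub_distrib, ← Finset.mul_sum, ← Finset.sum_mul]
  simp only [midpointSum, ← hM, Finset.sum_const, Finset.card_univ, Fintype.card_fin,
    nsmul_eq_mul, mul_one]
  have hpi := Real.pi_ne_zero
  change _ = 1 - ((∑ j, Real.cos (2 * Real.pi * X * τ j)) / M) ^ 2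
    - (∑ j, τ j * Real.sin (2 * Real.pi * X * τ j)) / M
      * ((∑ j, 2 * Real.pi * X * Real.sinc (2 * Real.pi * X * τ j)) / M)
  simp_rw [← Finset.mul_sum]
  generalize (∑ j, τ j * Real.sin (2 * Real.pi * X * τ j)) = A
  generalize (∑ j, Real.sinc (2 * Real.pi * X * τ j)) = B
  generalize (∑ j, Real.cos (2 * Real.pi * X * τ j)) = D
  field_simp
  ring

lemma integral_cos_mul (x : ℝ) : ∫ t in (0 : ℝ)..1, Real.cos (x * t) = sincDeriv 0 x := by
  simp [sincDeriv]

lemma integral_mul_sin_mul (x : ℝ) :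
    ∫ t in (0 : ℝ)..1, t * Real.sin (x * t) = -sincDeriv 1 x := by
  simp [sincDeriv, Real.cos_add_pi_div_two]

/-- Both sides are the squared modulus of the integral of `e^{2ixt}` over `[0, 1]`. This is why the
limit at `β = 2` depends on `πX` although the sums involve `2πX`. -/
lemma sincDeriv_sq_add_integral_sin_sq (x : ℝ) :
    sincDeriv 0 (2 * x) ^ 2 + (∫ t in (0 : ℝ)..1, Real.sin (2 * x * t)) ^ 2 = sincDeriv 0 x ^ 2 := by
  rcases eq_or_ne x 0 with rfl | hx
  · simp
  · have h1 := mul_sincDeriv_zero (2 * x)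
    have h2 := mul_sincDeriv_zero x
    have h3 : 2 * x * ∫ t in (0 : ℝ)..1, Real.sin (2 * x * t) = 1 - Real.cos (2 * x) := by
      rw [intervalIntegral.mul_integral_comp_mul_left]
      simp
    rw [Real.sin_two_mul] at h1
    rw [Real.cos_two_mul] at h3
    have h4 := Real.sin_sq_add_cos_sq x
    have hx2 : (2 * x) ^ 2 ≠ 0 := by positivity
    apply mul_left_cancel₀ hx2
    have e1 : (2 * x) ^ 2 * (sincDeriv 0 (2 * x) ^ 2
        + (∫ t in (0 : ℝ)..1, Real.sin (2 * x * t)) ^ 2)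
        = (2 * x * sincDeriv 0 (2 * x)) ^ 2
          + (2 * x * ∫ t in (0 : ℝ)..1, Real.sin (2 * x * t)) ^ 2 := by ring
    have e2 : (2 * x) ^ 2 * sincDeriv 0 x ^ 2 = 4 * (x * sincDeriv 0 x) ^ 2 := by ring
    rw [e1, e2, h1, h2, h3]
    have h5 : Real.cos x ^ 2 = 1 - Real.sin x ^ 2 := by linarith
    rw [mul_pow, h5]
    ring

lemma tendsto_scaledTwoPoint_two (X : ℝ) :
    Tendsto (fun N : ℕ => scaledTwoPoint 2 N X) atTop (𝓝 (bulkTwo (Real.pi * X))) := by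
  have h1 := tendsto_midpointSum (g := fun t => Real.cos (2 * Real.pi * X * t)) (by fun_prop)
  have h2 := tendsto_midpointSum (g := fun t => Real.sin (2 * Real.pi * X * t)) (by fun_prop)
  have h3 := ((h1.pow 2).const_sub 1).sub (h2.pow 2)
  refine Tendsto.congr' ?_ (h3.trans (le_of_eq ?_))
  · filter_upwards [eventually_ge_atTop 2] with N hN
    exact (scaledTwoPoint_two N hN X).symm
  · rw [integral_cos_mul, bulkTwo, ← sincDeriv_sq_add_integral_sin_sq (Real.pi * X), sub_sub,
      ← mul_assoc 2 Real.pi X]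

lemma tendsto_scaledTwoPoint_four (X : ℝ) :
    Tendsto (fun N : ℕ => scaledTwoPoint 4 N X) atTop (𝓝 (bulkFour (2 * Real.pi * X))) := by
  have hc := Real.continuous_sinc
  have h1 := tendsto_midpointSum (g := fun t => Real.cos (2 * Real.pi * X * t)) (by fun_prop)
  have h2 := tendsto_midpointSum (g := fun t => t * Real.sin (2 * Real.pi * X * t)) (by fun_prop)
  have h3 := tendsto_midpointSum
    (g := fun t => 2 * Real.pi * X * Real.sinc (2 * Real.pi * X * t)) (by fun_prop)
  have h4 := ((h1.pow 2).const_sub 1).sub (h2.mul h3)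
  refine Tendsto.congr' ?_ (h4.trans (le_of_eq ?_))
  · filter_upwards [eventually_ge_atTop 2] with N hN
    exact (scaledTwoPoint_four N hN X).symm
  · rw [integral_cos_mul, integral_mul_sin_mul, sineIntegral_mul, bulkFour]
    ring_nf

lemma bulkTwoPoint_two : bulkTwoPoint 2 = fun X => bulkTwo (Real.pi * X) :=
  funext fun X => (tendsto_scaledTwoPoint_two X).limUnder_eq

lemma bulkTwoPoint_four : bulkTwoPoint 4 = fun X => bulkFour (2 * Real.pi * X) :=
  funext fun X => (tendsto_scaledTwoPoint_four X).limUnder_eq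

end CircularEnsemble

theorem proposition2 :
    -- `β = 2`: existence of the bulk limit, smoothness, the third order equation, closed form
    ((∀ X : ℝ, Tendsto (fun N : ℕ => CircularEnsemble.scaledTwoPoint 2 N X) atTop
        (𝓝 (CircularEnsemble.bulkTwoPoint 2 X))) ∧
      ContDiff ℝ ∞ (CircularEnsemble.bulkTwoPoint 2) ∧
      (∀ X : ℝ,
        X ^ 3 * iteratedDeriv 3 (CircularEnsemble.bulkTwoPoint 2) X
          + 4 * X ^ 2 * iteratedDeriv 2 (CircularEnsemble.bulkTwoPoint 2) X
          + ((2 * Real.pi * X) ^ 2 - 2) * X * deriv (CircularEnsemble.bulkTwoPoint 2) X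
          - 4 * CircularEnsemble.bulkTwoPoint 2 X = 0) ∧
      (∀ X : ℝ, CircularEnsemble.bulkTwoPoint 2 X = 1 - Real.sinc (Real.pi * X) ^ 2)) ∧
    -- `β = 4`: existence of the bulk limit, smoothness, the fifth order equation, closed form
    ((∀ X : ℝ, Tendsto (fun N : ℕ => CircularEnsemble.scaledTwoPoint 4 N X) atTop
        (𝓝 (CircularEnsemble.bulkTwoPoint 4 X))) ∧
      ContDiff ℝ ∞ (CircularEnsemble.bulkTwoPoint 4) ∧
      (∀ X : ℝ,
        X ^ 5 * iteratedDeriv 5 (CircularEnsemble.bulkTwoPoint 4) X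
          + 10 * X ^ 4 * iteratedDeriv 4 (CircularEnsemble.bulkTwoPoint 4) X
          + (20 * Real.pi ^ 2 * X ^ 5 + 12 * X ^ 3)
            * iteratedDeriv 3 (CircularEnsemble.bulkTwoPoint 4) X
          + (64 * Real.pi ^ 2 * X ^ 4 - 40 * X ^ 2)
            * iteratedDeriv 2 (CircularEnsemble.bulkTwoPoint 4) X
          + (64 * Real.pi ^ 4 * X ^ 5 - 48 * Real.pi ^ 2 * X ^ 3 - 16 * X)
            * deriv (CircularEnsemble.bulkTwoPoint 4) X
          + (-32 * Real.pi ^ 2 * X ^ 2 + 16) * CircularEnsemble.bulkTwoPoint 4 X = 0) ∧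
      (∀ X : ℝ, CircularEnsemble.bulkTwoPoint 4 X =
        1 - Real.sinc (2 * Real.pi * X) ^ 2
          + 1 / (2 * Real.pi) * deriv (fun Y : ℝ => Real.sinc (2 * Real.pi * Y)) X
            * ∫ t in (0 : ℝ)..(2 * Real.pi * X), Real.sinc t)) := by
  -- Rescaling the variable by `c` multiplies the `k`-th derivative by `c ^ k`; this turns the
  -- equations in `x = πX` and `x = 2πX` into those in `X`.
  have hd : ∀ {f : ℝ → ℝ}, ContDiff ℝ ∞ f → ∀ (c : ℝ) (k : ℕ) (X : ℝ),
      iteratedDeriv k (fun Y => f (c * Y)) X = c ^ k * iteratedDeriv k f (c * X) :=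
    fun hf c k X => congrFun (iteratedDeriv_comp_const_mul (hf.of_le (by exact_mod_cast le_top)) c) X
  refine ⟨⟨fun X => ?_, ?_, fun X => ?_, fun X => ?_⟩, ⟨fun X => ?_, ?_, fun X => ?_, fun X => ?_⟩⟩
  · rw [CircularEnsemble.bulkTwoPoint_two]
    exact CircularEnsemble.tendsto_scaledTwoPoint_two X
  · rw [CircularEnsemble.bulkTwoPoint_two]
    exact CircularEnsemble.contDiff_bulkTwo.comp (contDiff_const.mul contDiff_id)
  · rw [← iteratedDeriv_one, CircularEnsemble.bulkTwoPoint_two]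
    simp only [hd CircularEnsemble.contDiff_bulkTwo]
    linear_combination CircularEnsemble.bulkTwo_ode (Real.pi * X)
  · rw [CircularEnsemble.bulkTwoPoint_two, ← CircularEnsemble.sincDeriv_zero]
    rfl
  · rw [CircularEnsemble.bulkTwoPoint_four]
    exact CircularEnsemble.tendsto_scaledTwoPoint_four X
  · rw [CircularEnsemble.bulkTwoPoint_four]
    exact CircularEnsemble.contDiff_bulkFour.comp (contDiff_const.mul contDiff_id)
  · rw [← iteratedDeriv_one, CircularEnsemble.bulkTwoPoint_four]
    simp only [hd CircularEnsemble.contDiff_bulkFour]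
    linear_combination CircularEnsemble.bulkFour_ode (2 * Real.pi * X)
  · have hderiv : deriv (fun Y : ℝ => Real.sinc (2 * Real.pi * Y)) X
        = 2 * Real.pi * CircularEnsemble.sincDeriv 1 (2 * Real.pi * X) := by
      rw [← CircularEnsemble.sincDeriv_zero, ← iteratedDeriv_one,
        hd (CircularEnsemble.contDiff_sincDeriv 0), pow_one, iteratedDeriv_one,
        (CircularEnsemble.hasDerivAt_sincDeriv 0 _).deriv]
    have hpi := Real.pi_ne_zero
    rw [hderiv, CircularEnsemble.bulkTwoPoint_four, ← CircularEnsemble.sincDeriv_zero]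
    simp only [CircularEnsemble.bulkFour, CircularEnsemble.sineIntegral,
      CircularEnsemble.sincDeriv_zero]
    field_simp
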